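/- Let $L>0$ be a real number and $N$ a positive integer. For $\varepsilon>0$ and $u=(u_1,u_2)\in H^1((0,1);\mathbb{R}^2)$ let $$E_\varepsilon(u)=\int_0^1 \frac{\varepsilon}{2}|u'|^2+\frac{1}{4\varepsilon}(|u|^2-1)^2+\frac{L}{2}\,(u_1u_2'-u_2u_1'-2\pi N)^2\,dx ,$$ and, identifying $\mathbb{R}^2$ with $\mathbb{C}$, for $\alpha\in[0,2\pi)$ let $$\mathcal{A}_\alpha=\{u\in H^1((0,1);\mathbb{R}^2):\ u(0)=1,\ u(1)=e^{i\alpha}\}.$$ An $H^1$-local minimizer of $E_\varepsilon$ within $\mathcal{A}_\alpha$ is a $u\in\mathcal{A}_\alpha$ for which there is $\delta>0$ such that $E_\varepsilon(u)\le E_\varepsilon(v)$ for all $v\in\mathcal{A}_\alpha$ with $\|v-u\|_{H^1(0,1)}<\delta$. **Theorem.** For every positive integer $M$ and every $\alpha\in[0,2\pi)$ there exists $\varepsilon_0>0$ such that for all $0<\varepsilon<\varepsilon_0$ there is an $H^1$-local minimizer $u_{\varepsilon,M}=\rho_{\varepsilon,M}e^{i\theta_{\varepsilon,M}}$ of $E_\varepsilon$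 within $\mathcal{A}_\alpha$, where $\rho_{\varepsilon,M},\theta_{\varepsilon,M}\in H^1(0,1)$, $\rho_{\varepsilon,M}>0$ on $[0,1]$, $\theta_{\varepsilon,M}\in C^1([0,1])$, $\theta_{\varepsilon,M}(0)=0$ and $\theta_{\varepsilon,M}(1)=2\pi M+\alpha$, such that $$\limsup_{\varepsilon\to0^+}\frac{\|\rho_{\varepsilon,M}-1\|_{L^\infty(0,1)}}{\varepsilon}<\infty,$$ $$\lim_{\varepsilon\to0^+}\theta_{\varepsilon,M}'=2\pi M+\alpha\quad\text{uniformly in }x\in[0,1],$$ $$\lim_{\varepsilon\to0^+}E_\varepsilon(u_{\varepsilon,M})=\frac{L}{2}\bigl(2\pi(M-N)+\alpha\bigr)^2 .$$ -/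

import Mathlib

open MeasureTheory Set Filter Topology
open scoped ContDiff

noncomputable section

namespace CholestericTwist

/-- Lebesgue measure on the open interval `(0,1)`. -/
def unitMeasure : Measure ℝ := volume.restrict (Ioo (0 : ℝ) 1)

/-- `g` is a weak derivative of `u` on `(0,1)`:
`∫ φ' u = - ∫ φ g` for all test functions `φ ∈ C_c^∞((0,1))`. -/
def HasWeakDeriv {F : Type*} [NormedAddCommGroup F] [NormedSpace ℝ F] (u g : ℝ → F) : Prop :=
  ∀ φ : ℝ → ℝ, ContDiff ℝ ∞ φ → HasCompactSupport φ → tsupport φ ⊆ Ioo (0 : ℝ) 1 →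
    ∫ x, deriv φ x • u x ∂unitMeasure = - ∫ x, φ x • g x ∂unitMeasure

/-- `u ∈ H¹((0,1); F)`: `u` is square integrable and has a square integrable weak derivative.
As usual in one dimension, `u` stands for the representative that is continuous on `[0,1]`,
so that pointwise and boundary values make sense. Values outside `[0,1]` play no role. -/
def MemH1 {F : Type*} [NormedAddCommGroup F] [NormedSpace ℝ F] (u : ℝ → F) : Prop :=
  ContinuousOn u (Icc (0 : ℝ) 1) ∧ MemLp u 2 unitMeasure ∧
    ∃ g : ℝ → F, MemLp g 2 unitMeasure ∧ HasWeakDeriv u g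

open Classical in
/-- The weak derivative `u'` of `u ∈ H¹((0,1); F)` (determined up to null sets);
by convention `0` if `u` has no square integrable weak derivative. -/
def weakDeriv {F : Type*} [NormedAddCommGroup F] [NormedSpace ℝ F] (u : ℝ → F) : ℝ → F :=
  if h : ∃ g : ℝ → F, MemLp g 2 unitMeasure ∧ HasWeakDeriv u g then h.choose else 0

/-- The norm of `H¹((0,1); F)`. -/
def h1Norm {F : Type*} [NormedAddCommGroup F] [NormedSpace ℝ F] (u : ℝ → F) : ℝ :=
  Real.sqrt ((∫ x, ‖u x‖ ^ 2 ∂unitMeasure) + ∫ x, ‖weakDeriv u x‖ ^ 2 ∂unitMeasure)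

/-- The admissible class `𝒜_α` of `u ∈ H¹((0,1); ℝ²)`, `ℝ² = ℂ`, with
`u(0) = 1` and `u(1) = e^{iα}`. -/
def admissible (α : ℝ) : Set (ℝ → ℂ) :=
  {u | MemH1 u ∧ u 0 = 1 ∧ u 1 = Complex.exp (Complex.I * (α : ℂ))}

/-- The twist `𝒯(u) = u₁ u₂' - u₂ u₁'`. -/
def twist (u : ℝ → ℂ) (x : ℝ) : ℝ :=
  (u x).re * (weakDeriv u x).im - (u x).im * (weakDeriv u x).re

/-- The energy
`E_ε(u) = ∫₀¹ (ε/2)|u'|² + (1/(4ε))(|u|² - 1)² + (L/2)(𝒯(u) - 2πN)² dx`. -/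
def energy (N : ℕ) (L ε : ℝ) (u : ℝ → ℂ) : ℝ :=
  ∫ x, (ε / 2 * ‖weakDeriv u x‖ ^ 2 + 1 / (4 * ε) * (‖u x‖ ^ 2 - 1) ^ 2
    + L / 2 * (twist u x - 2 * Real.pi * N) ^ 2) ∂unitMeasure

/-- `u` is an `H¹`-local minimizer of the functional `E` within the class `A`. -/
def IsH1LocalMinimizer (E : (ℝ → ℂ) → ℝ) (A : Set (ℝ → ℂ)) (u : ℝ → ℂ) : Prop :=
  u ∈ A ∧ ∃ δ > 0, ∀ v ∈ A, h1Norm (fun x => v x - u x) < δ → E u ≤ E v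

end CholestericTwist

end

namespace CholestericTwist

/-! ### Weak derivatives on the unit interval -/

/-! Put `T = 2πN`, `β = 2πM + α` and write `u = ρ e^{iθ}` with twist `p = ρ²θ'`. The energy density
becomes `(ε/2)ρ'² + (ε/2)p²/ρ² + (ρ²-1)²/(4ε) + (L/2)(p-T)²`, and prescribing the winding is the
constraint `∫ p/ρ² = β`. A critical point is built explicitly and then shown to be a local minimizer
by convexity; no compactness argument and no second variation enter.

Existence. For fixed `ρ` the problem in `p` is quadratic with one linear constraint, so `p = (TLρ² +
l)/(Lρ² + ε)` with an explicit multiplier `l`. Inserting this in the equation for `ρ = 1 + s` leaves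
the nonlocal problem `ε²s'' = 2s + 3s² + s³ - εg(s)`, `s(0) = s(1) = 0`, where `g` is bounded and
Lipschitz uniformly in `ε`. The Dirichlet inverse of `-d²/dx² + 2/ε²` has sup norm at most `ε²/2`,
so a contraction on a small ball gives `s = O(ε)` and `s' = O(1)` (`exists_boundary_layer`). At `s =
0` the frequency `θ'` is exactly `β`, whence `θ' = β + O(ε)`.

Minimality. An `H¹`-close competitor has modulus near one and the same winding
(`integral_log_deriv_eq_of_close`), so it meets the same constraint. The double well exceeds its
tangent line by at least `(s-t)²/(4ε)`, which for small `ε` absorbs every indefinite term of the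
Lagrangian density (`lagrangian_density_ge`). The density thus lies above its tangent plane at the
critical point, and the linear terms integrate to zero by the Euler-Lagrange equations and the
constraint (`polar_isH1LocalMinimizer`).

The stated limits are read off from the `O(ε)` bounds. -/

instance : IsFiniteMeasure unitMeasure := by
  unfold unitMeasure; infer_instance

theorem integral_unitMeasure {F : Type*} [NormedAddCommGroup F] [NormedSpace ℝ F] (f : ℝ → F) :
    ∫ x, f x ∂unitMeasure = ∫ x in (0 : ℝ)..1, f x := by
  rw [intervalIntegral.integral_of_le zero_le_one, unitMeasure, integral_Ioc_eq_integral_Ioo]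

theorem integrable_unitMeasure_iff {F : Type*} [NormedAddCommGroup F] {f : ℝ → F} :
    Integrable f unitMeasure ↔ IntervalIntegrable f volume 0 1 := by
  rw [intervalIntegrable_iff_integrableOn_Ioo_of_le zero_le_one, unitMeasure, IntegrableOn]

theorem ae_unitMeasure_iff {p : ℝ → Prop} :
    (∀ᵐ x ∂unitMeasure, p x) ↔ ∀ᵐ x, x ∈ Ioo (0 : ℝ) 1 → p x := by
  rw [unitMeasure, ae_restrict_iff' measurableSet_Ioo]

theorem memLp_unitMeasure_of_continuousOn {F : Type*} [NormedAddCommGroup F]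
    {f : ℝ → F} (hf : ContinuousOn f (Icc 0 1)) : MemLp f 2 unitMeasure := by
  obtain ⟨C, hC⟩ := isCompact_Icc.exists_bound_of_continuousOn hf
  refine MemLp.of_bound ((hf.mono Ioo_subset_Icc_self).aestronglyMeasurable measurableSet_Ioo) C ?_
  exact ae_unitMeasure_iff.2 (ae_of_all _ fun x hx => hC x (Ioo_subset_Icc_self hx))

theorem integrable_of_memLp_two {F : Type*} [NormedAddCommGroup F] {g : ℝ → F}
    (hg : MemLp g 2 unitMeasure) : Integrable g unitMeasure :=
  hg.integrable (by norm_num)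

theorem exists_Icc_of_compact {K : Set ℝ} (hK : IsCompact K) (h : K ⊆ Ioo 0 1) :
    ∃ a b : ℝ, 0 < a ∧ a ≤ b ∧ b < 1 ∧ K ⊆ Icc a b := by
  -- Adjoining `1/2` makes the set nonempty, so that extrema exist even when `K` is empty.
  have hK' : IsCompact (K ∪ {1 / 2}) := hK.union isCompact_singleton
  have hs : K ∪ {1 / 2} ⊆ Ioo (0 : ℝ) 1 := union_subset h (by norm_num)
  have hne : (K ∪ {1 / 2}).Nonempty := ⟨1 / 2, by simp⟩
  obtain ⟨a, ha⟩ := hK'.exists_isLeast hne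
  obtain ⟨b, hb⟩ := hK'.exists_isGreatest hne
  exact ⟨a, b, (hs ha.1).1, ha.2 hb.1, (hs hb.1).2,
    fun x hx => ⟨ha.2 (Or.inl hx), hb.2 (Or.inl hx)⟩⟩

theorem HasWeakDeriv.of_hasDerivAt {F : Type*} [NormedAddCommGroup F] [NormedSpace ℝ F]
    [CompleteSpace F] {u u' : ℝ → F} (h : ∀ x, HasDerivAt u (u' x) x) (hc : Continuous u') :
    HasWeakDeriv u u' := by
  intro φ hφ hs ht
  have hφd : ∀ x, HasDerivAt φ (deriv φ x) x := fun x =>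
    (hφ.differentiable (by simp) x).hasDerivAt
  have hφc : Continuous (deriv φ) := hφ.continuous_deriv (by simp)
  have huc : Continuous u := continuous_iff_continuousAt.2 fun x => (h x).continuousAt
  have h0 : φ 0 = 0 := image_eq_zero_of_notMem_tsupport fun hx => lt_irrefl _ (ht hx).1
  have h1 : φ 1 = 0 := image_eq_zero_of_notMem_tsupport fun hx => lt_irrefl _ (ht hx).2
  have i1 : IntervalIntegrable (fun x => deriv φ x • u x) volume 0 1 :=
    (hφc.smul huc).intervalIntegrable _ _
  have i2 : IntervalIntegrable (fun x => φ x • u' x) volume 0 1 :=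
    (hφ.continuous.smul hc).intervalIntegrable _ _
  rw [integral_unitMeasure, integral_unitMeasure, eq_neg_iff_add_eq_zero,
    ← intervalIntegral.integral_add i1 i2]
  rw [intervalIntegral.integral_eq_sub_of_hasDerivAt (f := fun x => φ x • u x)
    (fun x _ => by simpa [add_comm] using (hφd x).fun_smul (h x))
    (i1.add i2)]
  simp [h0, h1]

theorem MemH1.of_hasDerivAt {F : Type*} [NormedAddCommGroup F] [NormedSpace ℝ F]
    [CompleteSpace F] {u u' : ℝ → F} (h : ∀ x, HasDerivAt u (u' x) x) (hc : Continuous u') :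
    MemH1 u := by
  have huc : Continuous u := continuous_iff_continuousAt.2 fun x => (h x).continuousAt
  exact ⟨huc.continuousOn, memLp_unitMeasure_of_continuousOn huc.continuousOn, u',
    memLp_unitMeasure_of_continuousOn hc.continuousOn, .of_hasDerivAt h hc⟩

theorem MemH1.memLp_weakDeriv {F : Type*} [NormedAddCommGroup F] [NormedSpace ℝ F]
    {u : ℝ → F} (h : MemH1 u) : MemLp (weakDeriv u) 2 unitMeasure := by
  rw [weakDeriv, dif_pos h.2.2]; exact h.2.2.choose_spec.1

theorem MemH1.hasWeakDeriv {F : Type*} [NormedAddCommGroup F] [NormedSpace ℝ F]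
    {u : ℝ → F} (h : MemH1 u) : HasWeakDeriv u (weakDeriv u) := by
  rw [weakDeriv, dif_pos h.2.2]; exact h.2.2.choose_spec.2

theorem integrable_test_smul {F : Type*} [NormedAddCommGroup F] [NormedSpace ℝ F]
    {φ : ℝ → ℝ} (hφ : Continuous φ) (hs : HasCompactSupport φ) {g : ℝ → F}
    (hg : Integrable g unitMeasure) : Integrable (fun x => φ x • g x) unitMeasure := by
  obtain ⟨C, hC⟩ := hφ.bounded_above_of_compact_support hs
  exact hg.bdd_smul C hφ.aestronglyMeasurable (ae_of_all _ hC)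

theorem integral_unitMeasure_test {F : Type*} [NormedAddCommGroup F] [NormedSpace ℝ F]
    {φ : ℝ → ℝ} (ht : tsupport φ ⊆ Ioo 0 1) (g : ℝ → F) :
    ∫ x, φ x • g x ∂unitMeasure = ∫ x, φ x • g x := by
  refine setIntegral_eq_integral_of_forall_compl_eq_zero fun x hx => ?_
  rw [image_eq_zero_of_notMem_tsupport fun h => hx (ht h), zero_smul]

theorem ae_eq_zero_of_test {F : Type*} [NormedAddCommGroup F] [NormedSpace ℝ F]
    [FiniteDimensional ℝ F] {g : ℝ → F} (hg : Integrable g unitMeasure)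
    (h : ∀ φ : ℝ → ℝ, ContDiff ℝ ∞ φ → HasCompactSupport φ → tsupport φ ⊆ Ioo (0 : ℝ) 1 →
      ∫ x, φ x • g x ∂unitMeasure = 0) : g =ᵐ[unitMeasure] 0 := by
  have : CompleteSpace F := FiniteDimensional.complete ℝ F
  have hli : LocallyIntegrableOn g (Ioo 0 1) volume :=
    IntegrableOn.locallyIntegrableOn hg
  exact ae_unitMeasure_iff.2 (isOpen_Ioo.ae_eq_zero_of_integral_contDiff_smul_eq_zero hli
    fun φ h1 h2 h3 => by rw [← integral_unitMeasure_test h3, h φ h1 h2 h3])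

/-- Since `weakDeriv` is an arbitrary choice, this is what allows a computed derivative to replace
it under an integral. -/
theorem HasWeakDeriv.unique {F : Type*} [NormedAddCommGroup F] [NormedSpace ℝ F]
    [FiniteDimensional ℝ F] {u g g' : ℝ → F} (h : HasWeakDeriv u g) (h' : HasWeakDeriv u g')
    (hg : MemLp g 2 unitMeasure) (hg' : MemLp g' 2 unitMeasure) : g =ᵐ[unitMeasure] g' := by
  have hi := integrable_of_memLp_two hg
  have hi' := integrable_of_memLp_two hg'
  have := ae_eq_zero_of_test (hi.sub hi') fun φ h1 h2 h3 => by
    simp only [Pi.sub_apply, smul_sub]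
    rw [integral_sub (integrable_test_smul h1.continuous h2 hi)
      (integrable_test_smul h1.continuous h2 hi'), sub_eq_zero]
    exact neg_injective ((h φ h1 h2 h3).symm.trans (h' φ h1 h2 h3))
  filter_upwards [this] with x hx
  exact sub_eq_zero.1 hx

theorem weakDeriv_ae_eq_of_hasDerivAt {F : Type*} [NormedAddCommGroup F] [NormedSpace ℝ F]
    [FiniteDimensional ℝ F] {u u' : ℝ → F} (h : ∀ x, HasDerivAt u (u' x) x)
    (hc : Continuous u') : weakDeriv u =ᵐ[unitMeasure] u' := by
  have : CompleteSpace F := FiniteDimensional.complete ℝ F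
  have hu := MemH1.of_hasDerivAt h hc
  exact hu.hasWeakDeriv.unique (.of_hasDerivAt h hc) hu.memLp_weakDeriv
    (memLp_unitMeasure_of_continuousOn hc.continuousOn)

theorem HasWeakDeriv.sub {F : Type*} [NormedAddCommGroup F] [NormedSpace ℝ F]
    {u v g k : ℝ → F} (h : HasWeakDeriv u g) (h' : HasWeakDeriv v k)
    (hu : Integrable u unitMeasure) (hv : Integrable v unitMeasure)
    (hg : Integrable g unitMeasure) (hk : Integrable k unitMeasure) :
    HasWeakDeriv (fun x => u x - v x) (fun x => g x - k x) := by
  intro φ h1 h2 h3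
  have hc : Continuous (deriv φ) := h1.continuous_deriv (by simp)
  simp only [smul_sub]
  rw [integral_sub (integrable_test_smul hc h2.deriv hu) (integrable_test_smul hc h2.deriv hv),
    integral_sub (integrable_test_smul h1.continuous h2 hg)
      (integrable_test_smul h1.continuous h2 hk), h φ h1 h2 h3, h' φ h1 h2 h3]
  abel

theorem MemH1.sub {F : Type*} [NormedAddCommGroup F] [NormedSpace ℝ F] {u v : ℝ → F}
    (hu : MemH1 u) (hv : MemH1 v) : MemH1 (fun x => u x - v x) :=
  ⟨hu.1.sub hv.1, hu.2.1.sub hv.2.1, _, hu.memLp_weakDeriv.sub hv.memLp_weakDeriv,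
    hu.hasWeakDeriv.sub hv.hasWeakDeriv (integrable_of_memLp_two hu.2.1)
      (integrable_of_memLp_two hv.2.1) (integrable_of_memLp_two hu.memLp_weakDeriv)
      (integrable_of_memLp_two hv.memLp_weakDeriv)⟩

theorem weakDeriv_sub_ae {F : Type*} [NormedAddCommGroup F] [NormedSpace ℝ F]
    [FiniteDimensional ℝ F] {u v : ℝ → F} (hu : MemH1 u) (hv : MemH1 v) :
    weakDeriv (fun x => u x - v x) =ᵐ[unitMeasure] fun x => weakDeriv u x - weakDeriv v x :=
  (hu.sub hv).hasWeakDeriv.unique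
    (hu.hasWeakDeriv.sub hv.hasWeakDeriv (integrable_of_memLp_two hu.2.1)
      (integrable_of_memLp_two hv.2.1) (integrable_of_memLp_two hu.memLp_weakDeriv)
      (integrable_of_memLp_two hv.memLp_weakDeriv))
    (hu.sub hv).memLp_weakDeriv (hu.memLp_weakDeriv.sub hv.memLp_weakDeriv)

/-- A smooth compactly supported function with vanishing integral has a test function as
primitive. -/
theorem exists_test_primitive {χ : ℝ → ℝ} (hχ : ContDiff ℝ ∞ χ) (hs : HasCompactSupport χ)
    (ht : tsupport χ ⊆ Ioo 0 1) (h0 : ∫ x in (0 : ℝ)..1, χ x = 0) :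
    ∃ φ : ℝ → ℝ, ContDiff ℝ ∞ φ ∧ HasCompactSupport φ ∧ tsupport φ ⊆ Ioo 0 1 ∧
      deriv φ = χ := by
  obtain ⟨a, b, ha, hab, hb, hK⟩ := exists_Icc_of_compact hs ht
  have hz : ∀ x, x ∉ Icc a b → χ x = 0 := fun x hx =>
    image_eq_zero_of_notMem_tsupport fun h => hx (hK h)
  have hd : ∀ x, HasDerivAt (fun x => ∫ y in (0 : ℝ)..x, χ y) (χ x) x := fun x =>
    intervalIntegral.integral_hasDerivAt_right (hχ.continuous.intervalIntegrable _ _)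
      hχ.continuous.stronglyMeasurable.stronglyMeasurableAtFilter hχ.continuous.continuousAt
  have hderiv : deriv (fun x => ∫ y in (0 : ℝ)..x, χ y) = χ := funext fun x => (hd x).deriv
  have hsub : tsupport (fun x => ∫ y in (0 : ℝ)..x, χ y) ⊆ Icc a b := by
    refine closure_minimal ?_ isClosed_Icc
    intro x hx
    by_contra hxn
    refine hx ?_
    rcases lt_or_ge x a with hxa | hxa
    · refine intervalIntegral.integral_zero_ae (ae_of_all _ fun y hy => hz y fun hy' => ?_)
      have : y ≤ max 0 x := hy.2
      rcases le_max_iff.1 this with h | h <;> linarith [hy'.1]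
    · have hxb : b < x := by
        by_contra hbx
        exact hxn ⟨hxa, not_lt.1 hbx⟩
      -- To the right of `b` the primitive has collected the whole integral over `(0,1)`, which is
      -- zero; going from `1` to `x` adds nothing.
      have h1 : ∫ y in (1 : ℝ)..x, χ y = 0 := by
        refine intervalIntegral.integral_zero_ae (ae_of_all _ fun y hy => hz y fun hy' => ?_)
        have : min 1 x < y := hy.1
        rcases min_lt_iff.1 this with h | h <;> linarith [hy'.2]
      change ∫ y in (0 : ℝ)..x, χ y = 0
      rw [← intervalIntegral.integral_add_adjacent_intervals
        (hχ.continuous.intervalIntegrable 0 1) (hχ.continuous.intervalIntegrable 1 x), h0, h1,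
        add_zero]
  refine ⟨_, ?_, isCompact_Icc.of_isClosed_subset (isClosed_tsupport _) hsub,
    hsub.trans fun x hx => ⟨by linarith [hx.1], by linarith [hx.2]⟩, hderiv⟩
  exact contDiff_infty_iff_deriv.2 ⟨fun x => (hd x).differentiableAt, hderiv.symm ▸ hχ⟩

theorem exists_unit_test : ∃ ψ : ℝ → ℝ, ContDiff ℝ ∞ ψ ∧ HasCompactSupport ψ ∧
    tsupport ψ ⊆ Ioo 0 1 ∧ ∫ x in (0 : ℝ)..1, ψ x = 1 := by
  let f : ContDiffBump (1 / 2 : ℝ) := ⟨1 / 8, 1 / 4, by norm_num, by norm_num⟩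
  have ht : tsupport (f.normed volume) ⊆ Ioo 0 1 := by
    rw [f.tsupport_normed_eq, Real.closedBall_eq_Icc]
    intro x hx
    have h1 := hx.1
    have h2 := hx.2
    simp only [f] at h1 h2
    constructor <;> linarith
  refine ⟨f.normed volume, f.contDiff_normed, f.hasCompactSupport_normed, ht, ?_⟩
  have := integral_unitMeasure_test ht (fun _ => (1 : ℝ))
  simp only [smul_eq_mul, mul_one] at this
  rw [← integral_unitMeasure, this, f.integral_normed]

/-- The du Bois-Reymond lemma. -/
theorem const_of_hasWeakDeriv_zero {w : ℝ → ℝ} (hw : ContinuousOn w (Icc 0 1))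
    (h : HasWeakDeriv w 0) : ∃ c, ∀ x ∈ Icc (0 : ℝ) 1, w x = c := by
  obtain ⟨ψ, hψ, hψs, hψt, hψ1⟩ := exists_unit_test
  have hwi : Integrable w unitMeasure :=
    integrable_of_memLp_two (memLp_unitMeasure_of_continuousOn hw)
  set c := ∫ x, ψ x • w x ∂unitMeasure with hc
  have hci : Integrable (fun _ : ℝ => c) unitMeasure := integrable_const c
  have hz : (fun x => w x - c) =ᵐ[unitMeasure] 0 := by
    refine ae_eq_zero_of_test (hwi.sub hci) fun φ h1 h2 h3 => ?_
    -- Subtracting `m ψ` from `φ` makes its integral vanish, so the difference is the derivative of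
    -- a test function and can be paired with `w`.
    set m := ∫ x in (0 : ℝ)..1, φ x with hm
    have hχ : ContDiff ℝ ∞ fun x => φ x - m * ψ x := h1.sub (contDiff_const.mul hψ)
    have hsub : tsupport (fun x => φ x - m * ψ x) ⊆ tsupport φ ∪ tsupport ψ := by
      refine closure_minimal (fun x hx => ?_) ((isClosed_tsupport _).union (isClosed_tsupport _))
      by_contra hn
      rw [mem_union, not_or] at hn
      exact hx (by simp [image_eq_zero_of_notMem_tsupport hn.1,
        image_eq_zero_of_notMem_tsupport hn.2])
    have hχs : HasCompactSupport fun x => φ x - m * ψ x :=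
      (h2.isCompact.union hψs.isCompact).of_isClosed_subset (isClosed_tsupport _) hsub
    obtain ⟨Φ, hΦ, hΦs, hΦt, hΦd⟩ := exists_test_primitive hχ hχs
      (hsub.trans (union_subset h3 hψt)) (by
        rw [intervalIntegral.integral_sub (h1.continuous.intervalIntegrable _ _)
          ((hψ.continuous.intervalIntegrable _ _).const_mul m),
          intervalIntegral.integral_const_mul, hψ1, ← hm, mul_one, sub_self])
    have key := h Φ hΦ hΦs hΦt
    rw [hΦd] at key
    simp only [Pi.zero_apply, smul_zero, integral_zero, neg_zero, sub_smul] at key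
    rw [integral_sub (integrable_test_smul h1.continuous h2 hwi)] at key
    · simp only [smul_eq_mul, mul_assoc] at key
      rw [integral_const_mul] at key
      simp only [smul_sub]
      rw [integral_sub (integrable_test_smul h1.continuous h2 hwi)
        (integrable_test_smul h1.continuous h2 hci)]
      simp only [smul_eq_mul] at hc ⊢
      rw [integral_mul_const, ← hc, integral_unitMeasure φ, ← hm] at *
      linarith
    · exact integrable_test_smul (continuous_const.mul hψ.continuous)
        (hψs.mul_left (f := fun _ => m)) hwi
  have hae : ∀ᵐ x ∂(volume.restrict (Ioo (0 : ℝ) 1)), w x = (fun _ => c) x := by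
    filter_upwards [hz] with x hx using sub_eq_zero.1 hx
  have hIoo : EqOn w (fun _ => c) (Ioo 0 1) :=
    Measure.eqOn_open_of_ae_eq hae isOpen_Ioo (hw.mono Ioo_subset_Icc_self) continuousOn_const
  exact ⟨c, fun x hx => hIoo.of_subset_closure hw continuousOn_const Ioo_subset_Icc_self
    (by rw [closure_Ioo zero_ne_one]) hx⟩

/-- Integration by parts for absolutely continuous functions, with Lebesgue differentiation
identifying the a.e. derivative of the primitive. -/
theorem hasWeakDeriv_primitive {g : ℝ → ℝ} (hg : IntervalIntegrable g volume 0 1) :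
    HasWeakDeriv (fun x => ∫ y in (0 : ℝ)..x, g y) g := by
  intro φ h1 h2 h3
  have hac := hg.absolutelyContinuousOnInterval_intervalIntegral (c := 0) (by simp)
  have hφac : AbsolutelyContinuousOnInterval φ 0 1 :=
    (h1.of_le (by simp)).contDiffOn.absolutelyContinuousOnInterval
  have h0 : φ 0 = 0 := image_eq_zero_of_notMem_tsupport fun hx => lt_irrefl _ (h3 hx).1
  have h1' : φ 1 = 0 := image_eq_zero_of_notMem_tsupport fun hx => lt_irrefl _ (h3 hx).2
  have key := hφac.integral_mul_deriv_eq_deriv_mul hac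
  rw [h0, h1'] at key
  rw [integral_unitMeasure, integral_unitMeasure]
  simp only [smul_eq_mul]
  have : ∫ x in (0 : ℝ)..1, φ x * g x =
      ∫ x in (0 : ℝ)..1, φ x * deriv (fun x => ∫ y in (0 : ℝ)..x, g y) x := by
    refine intervalIntegral.integral_congr_ae ?_
    filter_upwards [hg.ae_hasDerivAt_integral] with x hx hx'
    rw [(hx (uIoc_subset_uIcc hx') 0 (by simp)).deriv]
  rw [this, key]
  ring

/-- The difference between `u` and the primitive of `g` has weak derivative zero, hence is constant.
-/
theorem eq_add_integral_of_hasWeakDeriv {u g : ℝ → ℝ} (hu : ContinuousOn u (Icc 0 1))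
    (hg : Integrable g unitMeasure) (h : HasWeakDeriv u g) :
    ∀ x ∈ Icc (0 : ℝ) 1, u x = u 0 + ∫ y in (0 : ℝ)..x, g y := by
  have hgi := integrable_unitMeasure_iff.1 hg
  have hac := hgi.absolutelyContinuousOnInterval_intervalIntegral (c := 0) (by simp)
  have hPc : ContinuousOn (fun x => ∫ y in (0 : ℝ)..x, g y) (Icc 0 1) := by
    simpa using hac.continuousOn
  have hw := h.sub (hasWeakDeriv_primitive hgi)
    (integrable_of_memLp_two (memLp_unitMeasure_of_continuousOn hu))
    (integrable_of_memLp_two (memLp_unitMeasure_of_continuousOn hPc)) hg hg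
  simp only [sub_self] at hw
  obtain ⟨c, hc⟩ := const_of_hasWeakDeriv_zero (w := fun x => u x - ∫ y in (0 : ℝ)..x, g y)
    (hu.sub hPc) hw
  intro x hx
  have hx1 := hc x hx
  have h0 := hc 0 (by simp)
  simp only [intervalIntegral.integral_same, sub_zero] at h0
  linarith

theorem HasWeakDeriv.clm_comp {F G : Type*} [NormedAddCommGroup F] [NormedSpace ℝ F]
    [CompleteSpace F] [NormedAddCommGroup G] [NormedSpace ℝ G] [CompleteSpace G] {u g : ℝ → F}
    (h : HasWeakDeriv u g) (hu : Integrable u unitMeasure) (hg : Integrable g unitMeasure)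
    (A : F →L[ℝ] G) : HasWeakDeriv (fun x => A (u x)) (fun x => A (g x)) := by
  intro φ h1 h2 h3
  have hc : Continuous (deriv φ) := h1.continuous_deriv (by simp)
  have := congrArg A (h φ h1 h2 h3)
  rw [map_neg, ← A.integral_comp_comm (integrable_test_smul hc h2.deriv hu),
    ← A.integral_comp_comm (integrable_test_smul h1.continuous h2 hg)] at this
  simpa only [map_smul] using this

/-! ### Absolutely continuous competitors -/

theorem absolutelyContinuousOnInterval_lipschitz_comp {X Y : Type*} [PseudoMetricSpace X]
    [PseudoMetricSpace Y] {f : ℝ → X} {φ : X → Y} {s : Set X} {K : NNReal} {a b : ℝ}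
    (hφ : LipschitzOnWith K φ s) (hf : AbsolutelyContinuousOnInterval f a b)
    (hs : ∀ x ∈ uIcc a b, f x ∈ s) : AbsolutelyContinuousOnInterval (fun x => φ (f x)) a b := by
  rw [absolutelyContinuousOnInterval_iff] at hf ⊢
  intro ε hε
  -- `K + 1` rather than `K`, because `K` may be zero.
  obtain ⟨δ, hδ, h⟩ := hf (ε / (K + 1)) (by positivity)
  refine ⟨δ, hδ, fun E hE hlt => ?_⟩
  have h1 := h E hE hlt
  calc ∑ i ∈ Finset.range E.1, dist (φ (f (E.2 i).1)) (φ (f (E.2 i).2))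
      ≤ ∑ i ∈ Finset.range E.1, K * dist (f (E.2 i).1) (f (E.2 i).2) :=
        Finset.sum_le_sum fun i hi =>
          hφ.dist_le_mul _ (hs _ (hE.1 i hi).1) _ (hs _ (hE.1 i hi).2)
    _ = K * ∑ i ∈ Finset.range E.1, dist (f (E.2 i).1) (f (E.2 i).2) := by rw [Finset.mul_sum]
    _ ≤ (K + 1) * ∑ i ∈ Finset.range E.1, dist (f (E.2 i).1) (f (E.2 i).2) :=
        mul_le_mul_of_nonneg_right (by simp) (Finset.sum_nonneg fun i _ => dist_nonneg)
    _ < (K + 1) * (ε / (K + 1)) := mul_lt_mul_of_pos_left h1 (by positivity)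
    _ = ε := by field_simp

theorem absolutelyContinuousOnInterval_complex_primitive {g : ℝ → ℂ}
    (hg : IntervalIntegrable g volume 0 1) :
    AbsolutelyContinuousOnInterval (fun x => ∫ y in (0 : ℝ)..x, g y) 0 1 := by
  have hre : IntervalIntegrable (fun x => (g x).re) volume 0 1 :=
    integrable_unitMeasure_iff.1 (integrable_unitMeasure_iff.2 hg).re
  have him : IntervalIntegrable (fun x => (g x).im) volume 0 1 :=
    integrable_unitMeasure_iff.1 (integrable_unitMeasure_iff.2 hg).im
  have h1 := absolutelyContinuousOnInterval_lipschitz_comp (s := univ)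
    Complex.isometry_ofReal.lipschitz.lipschitzOnWith
    (hre.absolutelyContinuousOnInterval_intervalIntegral (c := 0) (by simp)) (by simp)
  have h2 := absolutelyContinuousOnInterval_lipschitz_comp (s := univ)
    Complex.isometry_ofReal.lipschitz.lipschitzOnWith
    (him.absolutelyContinuousOnInterval_intervalIntegral (c := 0) (by simp)) (by simp)
  have h3 := h1.add (h2.const_smul Complex.I)
  rw [absolutelyContinuousOnInterval_iff] at h3 ⊢
  have key : ∀ x ∈ uIcc (0 : ℝ) 1, ∫ y in (0 : ℝ)..x, g y =
      ((∫ y in (0 : ℝ)..x, (g y).re : ℝ) : ℂ) + Complex.I • ((∫ y in (0 : ℝ)..x, (g y).im : ℝ) : ℂ) := by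
    intro x hx
    have hgx : IntervalIntegrable g volume 0 x := hg.mono_set (uIcc_subset_uIcc_left hx)
    apply Complex.ext
    · have := Complex.reCLM.intervalIntegral_comp_comm hgx
      simpa using this.symm
    · have := Complex.imCLM.intervalIntegral_comp_comm hgx
      simpa using this.symm
  intro ε hε
  obtain ⟨δ, hδ, h⟩ := h3 ε hε
  refine ⟨δ, hδ, fun E hE hlt => ?_⟩
  convert h E hE hlt using 1
  refine Finset.sum_congr rfl fun i hi => ?_
  rw [key _ (hE.1 i hi).1, key _ (hE.1 i hi).2]
  rfl

theorem MemH1.eq_add_integral {v : ℝ → ℂ} (hv : MemH1 v) :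
    ∀ x ∈ Icc (0 : ℝ) 1, v x = v 0 + ∫ y in (0 : ℝ)..x, weakDeriv v y := by
  have hvi := integrable_of_memLp_two hv.2.1
  have hgi := integrable_of_memLp_two hv.memLp_weakDeriv
  intro x hx
  have hgx : IntervalIntegrable (weakDeriv v) volume 0 x :=
    (integrable_unitMeasure_iff.1 hgi).mono_set
      (uIcc_subset_uIcc_left (by simpa using hx))
  apply Complex.ext
  · have h1 := eq_add_integral_of_hasWeakDeriv (u := fun x => (v x).re)
      (Complex.continuous_re.comp_continuousOn hv.1) hgi.re
      (hv.hasWeakDeriv.clm_comp hvi hgi Complex.reCLM) x hx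
    have := Complex.reCLM.intervalIntegral_comp_comm hgx
    simp only [Complex.reCLM_apply] at this
    rw [Complex.add_re, ← this]
    exact h1
  · have h1 := eq_add_integral_of_hasWeakDeriv (u := fun x => (v x).im)
      (Complex.continuous_im.comp_continuousOn hv.1) hgi.im
      (hv.hasWeakDeriv.clm_comp hvi hgi Complex.imCLM) x hx
    have := Complex.imCLM.intervalIntegral_comp_comm hgx
    simp only [Complex.imCLM_apply] at this
    rw [Complex.add_im, ← this]
    exact h1

/-- The absolutely continuous representative of an `H¹` function, defined on the whole line. -/
theorem MemH1.exists_ac {v : ℝ → ℂ} (hv : MemH1 v) : ∃ V : ℝ → ℂ,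
    (∀ x ∈ Icc (0 : ℝ) 1, V x = v x) ∧ AbsolutelyContinuousOnInterval V 0 1 ∧
    ∀ᵐ x, x ∈ uIcc (0 : ℝ) 1 → HasDerivAt V (weakDeriv v x) x := by
  have hgi := integrable_unitMeasure_iff.1 (integrable_of_memLp_two hv.memLp_weakDeriv)
  refine ⟨fun x => v 0 + ∫ y in (0 : ℝ)..x, weakDeriv v y,
    fun x hx => (hv.eq_add_integral x hx).symm, ?_, ?_⟩
  · exact absolutelyContinuousOnInterval_lipschitz_comp (s := univ)
      (φ := fun z => v 0 + z) (K := 1)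
      (LipschitzWith.of_dist_le_mul fun z w => by simp).lipschitzOnWith
      (absolutelyContinuousOnInterval_complex_primitive hgi) (by simp)
  · filter_upwards [hgi.ae_hasDerivAt_integral] with x hx hx'
    exact (hx hx' 0 (by simp)).const_add _

/-- A nonvanishing `H¹` function is the exponential of the primitive of its logarithmic
derivative. -/
theorem MemH1.exp_integral_log_deriv {v : ℝ → ℂ} (hv : MemH1 v)
    (h0 : ∀ x ∈ Icc (0 : ℝ) 1, v x ≠ 0) (hi : Integrable (fun x => weakDeriv v x / v x) unitMeasure) :
    v 1 = v 0 * Complex.exp (∫ x in (0 : ℝ)..1, weakDeriv v x / v x) := by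
  obtain ⟨V, hV, hVac, hVd⟩ := hv.exists_ac
  have hi' := integrable_unitMeasure_iff.1 hi
  have hF := absolutelyContinuousOnInterval_complex_primitive hi'
  obtain ⟨R, hR⟩ := hF.exists_bound
  -- `z ↦ exp(-z)` is Lipschitz on a ball containing the range of the primitive, so absolute
  -- continuity survives. The product of `V` with it then has zero derivative a.e. and is constant.
  obtain ⟨K, hK⟩ := (Complex.contDiff_exp (𝕜 := ℝ) (n := 1)).comp contDiff_neg
    |>.contDiffOn.exists_lipschitzOnWith (s := Metric.closedBall 0 R) (by simp)
      (convex_closedBall _ _) (isCompact_closedBall _ _)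
  have hE := absolutelyContinuousOnInterval_lipschitz_comp hK hF (fun x hx => by simpa using hR x hx)
  have hw := hVac.smul hE
  obtain ⟨c, hc⟩ := hw.const_of_ae_hasDerivAt_zero (by
    filter_upwards [hVd, hi'.ae_hasDerivAt_integral] with x h1 h2 hx
    have h3 := (h2 hx 0 (by simp)).neg.cexp
    have h4 := (h1 hx).mul h3
    have hx' : x ∈ Icc (0 : ℝ) 1 := by simpa using hx
    convert! h4 using 1
    rw [hV x hx']
    have := h0 x hx'
    field_simp
    simp)
  have e0 := hc 0 (by simp)
  have e1 := hc 1 (by simp)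
  simp only [Pi.smul_apply', smul_eq_mul, Function.comp_apply, intervalIntegral.integral_same,
    neg_zero, Complex.exp_zero, mul_one] at e0 e1
  rw [hV 0 (by simp)] at e0
  rw [hV 1 (by simp)] at e1
  rw [e0, ← e1, mul_assoc, ← Complex.exp_add]
  simp

theorem hasDerivAt_norm {V : ℝ → ℂ} {V' : ℂ} {x : ℝ} (h : HasDerivAt V V' x) (h0 : V x ≠ 0) :
    HasDerivAt (fun y => ‖V y‖) (inner ℝ (V x) V' / ‖V x‖) x := by
  have h1 := h.norm_sq.sqrt (by simpa using h0)
  have e : (fun y => √(‖V y‖ ^ 2)) = fun y => ‖V y‖ := by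
    funext y; exact Real.sqrt_sq (norm_nonneg _)
  rw [e, Real.sqrt_sq (norm_nonneg _)] at h1
  convert h1 using 1
  have : ‖V x‖ ≠ 0 := by simpa using h0
  field_simp

/-- Integration by parts against the modulus of a nonvanishing `H¹` function. -/
theorem MemH1.integral_norm_by_parts {v : ℝ → ℂ} (hv : MemH1 v)
    (h0 : ∀ x ∈ Icc (0 : ℝ) 1, v x ≠ 0) {f f' : ℝ → ℝ} (hf : ∀ x, HasDerivAt f (f' x) x)
    (hf' : Continuous f') :
    ∫ x in (0 : ℝ)..1, (f' x * ‖v x‖ + f x * (inner ℝ (v x) (weakDeriv v x) / ‖v x‖)) =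
      f 1 * ‖v 1‖ - f 0 * ‖v 0‖ := by
  obtain ⟨V, hV, hVac, hVd⟩ := hv.exists_ac
  have hN := absolutelyContinuousOnInterval_lipschitz_comp (s := univ)
    (lipschitzWith_one_norm (E := ℂ)).lipschitzOnWith hVac (by simp)
  have hfac : AbsolutelyContinuousOnInterval f 0 1 := by
    refine ContDiffOn.absolutelyContinuousOnInterval (ContDiff.contDiffOn ?_)
    refine contDiff_one_iff_deriv.2 ⟨fun x => (hf x).differentiableAt, ?_⟩
    rwa [show deriv f = f' from funext fun x => (hf x).deriv]
  have key := hfac.integral_deriv_mul_eq_sub hN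
  rw [hV 0 (by simp), hV 1 (by simp)] at key
  rw [← key]
  refine intervalIntegral.integral_congr_ae ?_
  filter_upwards [hVd] with x hx hx'
  have hx1 := uIoc_subset_uIcc hx'
  have hx2 : x ∈ Icc (0 : ℝ) 1 := by simpa using hx1
  rw [(hf x).deriv, (hasDerivAt_norm (hx hx1) (by rw [hV x hx2]; exact h0 x hx2)).deriv, hV x hx2]

/-! ### Sobolev embedding with constant one. -/

theorem integral_norm_le_sqrt {f : ℝ → ℂ} (hf : MemLp f 2 unitMeasure) :
    ∫ x, ‖f x‖ ∂unitMeasure ≤ √(∫ x, ‖f x‖ ^ 2 ∂unitMeasure) := by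
  have hi := (integrable_of_memLp_two hf).norm
  have h2 : Integrable (fun x => ‖f x‖ ^ 2) unitMeasure := hf.norm.integrable_sq
  have hm : ∀ c : ℝ, ∫ _, c ∂unitMeasure = c := fun c => by
    rw [integral_unitMeasure]; simp
  refine Real.le_sqrt_of_sq_le ?_
  set m := ∫ x, ‖f x‖ ∂unitMeasure
  have h0 : 0 ≤ ∫ x, (‖f x‖ - m) ^ 2 ∂unitMeasure := integral_nonneg fun x => sq_nonneg _
  have e : ∫ x, (‖f x‖ - m) ^ 2 ∂unitMeasure = (∫ x, ‖f x‖ ^ 2 ∂unitMeasure) - m ^ 2 := by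
    have : ∀ x, (‖f x‖ - m) ^ 2 = ‖f x‖ ^ 2 - (2 * m * ‖f x‖ - m ^ 2) := fun x => by ring
    simp_rw [this]
    have h3 : Integrable (fun x => 2 * m * ‖f x‖ - m ^ 2) unitMeasure :=
      (hi.const_mul _).sub (integrable_const _)
    rw [integral_sub h2 h3,
      integral_sub (hi.const_mul _) (integrable_const _), integral_const_mul, hm]
    change _ - (2 * m * m - m ^ 2) = _
    ring
  linarith

theorem MemH1.integral_norm_weakDeriv_le {w : ℝ → ℂ} (hw : MemH1 w) :
    ∫ x, ‖weakDeriv w x‖ ∂unitMeasure ≤ h1Norm w :=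
  (integral_norm_le_sqrt hw.memLp_weakDeriv).trans <| Real.sqrt_le_sqrt <|
    le_add_of_nonneg_left (integral_nonneg fun x => by positivity)

/-- Integrate the derivative from the left endpoint, where the difference of two admissible maps
vanishes. This turns `H¹` closeness into uniform closeness. -/
theorem MemH1.norm_le_h1Norm {w : ℝ → ℂ} (hw : MemH1 w) (h0 : w 0 = 0) {x : ℝ}
    (hx : x ∈ Icc (0 : ℝ) 1) : ‖w x‖ ≤ h1Norm w := by
  have hi := integrable_of_memLp_two hw.memLp_weakDeriv
  rw [hw.eq_add_integral x hx, h0, zero_add]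
  refine le_trans ?_ hw.integral_norm_weakDeriv_le
  rw [integral_unitMeasure]
  refine (intervalIntegral.norm_integral_le_integral_norm hx.1).trans ?_
  exact intervalIntegral.integral_mono_interval le_rfl hx.1 hx.2
    (ae_of_all _ fun x => norm_nonneg _) (integrable_unitMeasure_iff.1 hi.norm)

/-! ### Convexity of the dual energy and local minimality -/

/-- Both remainders factor exactly, with coefficients `(s+t)/(s²t²)` and `(2s+t)/(s²t³)`; the
constants bound these at the ends of the interval. -/
theorem inv_sq_taylor_bounds {s t : ℝ} (hs : s ∈ Icc (3 / 4 : ℝ) (5 / 4))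
    (ht : t ∈ Icc (3 / 4 : ℝ) (5 / 4)) :
    |1 / s ^ 2 - 1 / t ^ 2| ≤ 8 * |s - t| ∧
      |1 / s ^ 2 - 1 / t ^ 2 + 2 * (s - t) / t ^ 3| ≤ 16 * (s - t) ^ 2 := by
  obtain ⟨hs1, hs2⟩ := hs
  obtain ⟨ht1, ht2⟩ := ht
  have hs0 : 0 < s := by linarith
  have ht0 : 0 < t := by linarith
  have hs9 : 9 / 16 ≤ s ^ 2 := by nlinarith
  have ht9 : 9 / 16 ≤ t ^ 2 := by nlinarith
  have hst : 81 / 256 ≤ s ^ 2 * t ^ 2 := by nlinarith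
  have hst3 : 243 / 1024 ≤ s ^ 2 * t ^ 3 := by
    have : s ^ 2 * t ^ 3 = s ^ 2 * t ^ 2 * t := by ring
    rw [this]; nlinarith
  constructor
  · have : 1 / s ^ 2 - 1 / t ^ 2 = -((s + t) / (s ^ 2 * t ^ 2)) * (s - t) := by
      field_simp; ring
    rw [this, abs_mul, abs_neg, abs_of_nonneg (by positivity)]
    refine mul_le_mul_of_nonneg_right ?_ (abs_nonneg _)
    rw [div_le_iff₀ (by positivity)]
    linarith
  · have : 1 / s ^ 2 - 1 / t ^ 2 + 2 * (s - t) / t ^ 3 =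
        ((2 * s + t) / (s ^ 2 * t ^ 3)) * (s - t) ^ 2 := by
      field_simp; ring
    rw [this, abs_mul, abs_of_nonneg (by positivity), abs_of_nonneg (sq_nonneg _)]
    refine mul_le_mul_of_nonneg_right ?_ (sq_nonneg _)
    rw [div_le_iff₀ (by positivity)]
    linarith

/-- The remainder is `(s-t)²/(4ε)` times `2(t²-1) + (s+t)²`, a factor at least one when `s, t ≥
3/4`. Its blow-up as `ε → 0` is the source of all coercivity in the modulus. -/
theorem double_well_taylor_bound {s t ε : ℝ} (hε : 0 < ε) (hs : s ∈ Icc (3 / 4 : ℝ) (5 / 4))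
    (ht : t ∈ Icc (3 / 4 : ℝ) (5 / 4)) :
    1 / (4 * ε) * (s - t) ^ 2 ≤ 1 / (4 * ε) * (s ^ 2 - 1) ^ 2 - 1 / (4 * ε) * (t ^ 2 - 1) ^ 2 -
      t * (t ^ 2 - 1) / ε * (s - t) := by
  have e : 1 / (4 * ε) * (s ^ 2 - 1) ^ 2 - 1 / (4 * ε) * (t ^ 2 - 1) ^ 2 -
      t * (t ^ 2 - 1) / ε * (s - t) =
      1 / (4 * ε) * ((s - t) ^ 2 * (2 * (t ^ 2 - 1) + (s + t) ^ 2)) := by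
    field_simp; ring
  rw [e]
  refine mul_le_mul_of_nonneg_left ?_ (by positivity)
  refine le_mul_of_one_le_right (sq_nonneg _) ?_
  nlinarith [hs.1, ht.1]

/-- The Lagrangian density, in the modulus `s` and the twist `p`, lies above its tangent plane at
a critical pair `(t, p₀)`. -/
theorem lagrangian_density_ge {ε L T K l s t p p₀ : ℝ} (hε : 0 < ε) (hL : 0 < L)
    (hs : s ∈ Icc (3 / 4 : ℝ) (5 / 4)) (ht : t ∈ Icc (3 / 4 : ℝ) (5 / 4))
    (hl : l = ε * p₀ + L * t ^ 2 * (p₀ - T)) (h1 : |ε * p₀ - l| ≤ K)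
    (h2 : |ε * p₀ ^ 2 / 2 - l * p₀| ≤ K) (hK : 16 * K + 32 * K ^ 2 / L ≤ 1 / (4 * ε)) :
    ε / 2 * (p₀ ^ 2 / t ^ 2) + 1 / (4 * ε) * (t ^ 2 - 1) ^ 2 + L / 2 * (p₀ - T) ^ 2 +
        l * (p / s ^ 2 - p₀ / t ^ 2) +
        (t * (t ^ 2 - 1) / ε - (ε * p₀ ^ 2 - 2 * l * p₀) / t ^ 3) * (s - t) ≤
      ε / 2 * (p ^ 2 / s ^ 2) + 1 / (4 * ε) * (s ^ 2 - 1) ^ 2 + L / 2 * (p - T) ^ 2 := by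
  obtain ⟨b1, b2⟩ := inv_sq_taylor_bounds hs ht
  have hW := double_well_taylor_bound hε hs ht
  have ht0 : 0 < t := by linarith [ht.1]
  have hs0 : 0 < s := by linarith [hs.1]
  have hK0 : 0 ≤ K := (abs_nonneg _).trans h1
  set a := 1 / s ^ 2 with ha
  set b := 1 / t ^ 2 with hb
  -- Stationarity in the twist, which cancels the terms that are of first order in `p - p₀` alone.
  have hcrit : ε * b * p₀ + L * (p₀ - T) - l * b = 0 := by
    rw [hl, hb]; field_simp; ring
  have id : ε / 2 * (p ^ 2 / s ^ 2) + 1 / (4 * ε) * (s ^ 2 - 1) ^ 2 + L / 2 * (p - T) ^ 2 -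
      (ε / 2 * (p₀ ^ 2 / t ^ 2) + 1 / (4 * ε) * (t ^ 2 - 1) ^ 2 + L / 2 * (p₀ - T) ^ 2 +
        l * (p / s ^ 2 - p₀ / t ^ 2) +
        (t * (t ^ 2 - 1) / ε - (ε * p₀ ^ 2 - 2 * l * p₀) / t ^ 3) * (s - t)) =
      (ε * a / 2 + L / 2) * (p - p₀) ^ 2 + (p - p₀) * ((a - b) * (ε * p₀ - l)) +
      (a - b + 2 * (s - t) / t ^ 3) * (ε * p₀ ^ 2 / 2 - l * p₀) +
      (1 / (4 * ε) * (s ^ 2 - 1) ^ 2 - 1 / (4 * ε) * (t ^ 2 - 1) ^ 2 -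
        t * (t ^ 2 - 1) / ε * (s - t)) := by
    have e1 : p ^ 2 / s ^ 2 = a * p ^ 2 := by rw [ha]; ring
    have e2 : p₀ ^ 2 / t ^ 2 = b * p₀ ^ 2 := by rw [hb]; ring
    have e3 : p / s ^ 2 = a * p := by rw [ha]; ring
    have e4 : p₀ / t ^ 2 = b * p₀ := by rw [hb]; ring
    rw [e1, e2, e3, e4]
    linear_combination (p - p₀) * hcrit
  have t1 : -(8 * K * (|p - p₀| * |s - t|)) ≤ (p - p₀) * ((a - b) * (ε * p₀ - l)) := by
    refine (neg_le_neg ?_).trans (neg_abs_le _)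
    rw [abs_mul, abs_mul]
    calc |p - p₀| * (|a - b| * |ε * p₀ - l|) ≤ |p - p₀| * (8 * |s - t| * K) := by gcongr
      _ = 8 * K * (|p - p₀| * |s - t|) := by ring
  have t2 : -(16 * K * (s - t) ^ 2) ≤
      (a - b + 2 * (s - t) / t ^ 3) * (ε * p₀ ^ 2 / 2 - l * p₀) := by
    refine (neg_le_neg ?_).trans (neg_abs_le _)
    rw [abs_mul]
    calc _ ≤ 16 * (s - t) ^ 2 * K := by gcongr
      _ = 16 * K * (s - t) ^ 2 := by ring
  have t3 : L / 2 * (p - p₀) ^ 2 ≤ (ε * a / 2 + L / 2) * (p - p₀) ^ 2 := by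
    refine mul_le_mul_of_nonneg_right ?_ (sq_nonneg _)
    have : 0 ≤ ε * a / 2 := by positivity
    linarith
  have t4 : (16 * K + 32 * K ^ 2 / L) * (s - t) ^ 2 ≤ 1 / (4 * ε) * (s - t) ^ 2 :=
    mul_le_mul_of_nonneg_right hK (sq_nonneg _)
  -- Completing the square absorbs the cross term; this is where `32 K² / L` in `hK` comes from,
  -- while `16 K` pays for the second-order remainder of `1/s²`.
  have t5 : 0 ≤ L / 2 * (p - p₀) ^ 2 - 8 * K * (|p - p₀| * |s - t|) +
      32 * K ^ 2 / L * (s - t) ^ 2 := by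
    have : L / 2 * (p - p₀) ^ 2 - 8 * K * (|p - p₀| * |s - t|) + 32 * K ^ 2 / L * (s - t) ^ 2 =
        1 / (2 * L) * (L * |p - p₀| - 8 * K * |s - t|) ^ 2 := by
      rw [← sq_abs (p - p₀), ← sq_abs (s - t)]
      field_simp; ring
    rw [this]; positivity
  linarith

/-! ### Radial and angular parts of the derivative, and the winding. -/

theorem twist_div_eq_im (v g : ℂ) : (v.re * g.im - v.im * g.re) / ‖v‖ ^ 2 = (g / v).im := by
  rw [Complex.div_im, ← Complex.normSq_eq_norm_sq]; ring

/-- Pythagoras for the components of `g` along `v` and `iv`. -/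
theorem norm_sq_eq_radial_add_twist {v g : ℂ} (hv : v ≠ 0) :
    ‖g‖ ^ 2 = (inner ℝ v g / ‖v‖) ^ 2 + (v.re * g.im - v.im * g.re) ^ 2 / ‖v‖ ^ 2 := by
  have h : ‖v‖ ^ 2 ≠ 0 := by positivity
  rw [div_pow, ← add_div, eq_div_iff h, ← Complex.normSq_eq_norm_sq, ← Complex.normSq_eq_norm_sq,
    Complex.normSq_apply, Complex.normSq_apply, Complex.inner]
  simp
  ring

/-- Exponentiating the integral gives `v 1 / v 0 = e^{iα}`, so the total phase is quantized. -/
theorem exists_int_integral_log_deriv {α : ℝ} {v : ℝ → ℂ} (hv : v ∈ admissible α)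
    (h0 : ∀ x ∈ Icc (0 : ℝ) 1, v x ≠ 0) :
    Integrable (fun x => weakDeriv v x / v x) unitMeasure ∧
    ∃ n : ℤ, ∫ x, weakDeriv v x / v x ∂unitMeasure = Complex.I * α + n * (2 * Real.pi * Complex.I) := by
  obtain ⟨hv1, hv0, hve⟩ := hv
  have hi : Integrable (fun x => weakDeriv v x / v x) unitMeasure := by
    simp_rw [div_eq_mul_inv]
    refine integrable_unitMeasure_iff.2 (IntervalIntegrable.mul_continuousOn
      (integrable_unitMeasure_iff.1 (integrable_of_memLp_two hv1.memLp_weakDeriv)) ?_)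
    rw [uIcc_of_le zero_le_one]
    exact hv1.1.inv₀ h0
  refine ⟨hi, ?_⟩
  have := hv1.exp_integral_log_deriv h0 hi
  rw [hv0, hve, one_mul, Complex.exp_eq_exp_iff_exists_int] at this
  obtain ⟨n, hn⟩ := this
  refine ⟨-n, ?_⟩
  rw [integral_unitMeasure, hn]
  push_cast
  ring

/-- The winding is locally constant in `H¹`. -/
theorem integral_log_deriv_eq_of_close {α : ℝ} {u v : ℝ → ℂ} (hu : u ∈ admissible α)
    (hv : v ∈ admissible α) (hu0 : ∀ x ∈ Icc (0 : ℝ) 1, 3 / 4 ≤ ‖u x‖)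
    (hv0 : ∀ x ∈ Icc (0 : ℝ) 1, 3 / 4 ≤ ‖v x‖)
    (h : h1Norm (fun x => v x - u x) * (1 + ∫ x, ‖weakDeriv u x‖ ∂unitMeasure) < 1) :
    ∫ x, weakDeriv v x / v x ∂unitMeasure = ∫ x, weakDeriv u x / u x ∂unitMeasure := by
  have hun : ∀ x ∈ Icc (0 : ℝ) 1, u x ≠ 0 := fun x hx h => by
    have := hu0 x hx; rw [h, norm_zero] at this; linarith
  have hvn : ∀ x ∈ Icc (0 : ℝ) 1, v x ≠ 0 := fun x hx h => by
    have := hv0 x hx; rw [h, norm_zero] at this; linarith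
  obtain ⟨hui, n, hn⟩ := exists_int_integral_log_deriv hu hun
  obtain ⟨hvi, m, hm⟩ := exists_int_integral_log_deriv hv hvn
  have hw := hv.1.sub hu.1
  set η := h1Norm (fun x => v x - u x)
  set B := ∫ x, ‖weakDeriv u x‖ ∂unitMeasure with hB
  have hB0 : 0 ≤ B := integral_nonneg fun x => norm_nonneg _
  have hη : 0 ≤ η := Real.sqrt_nonneg _
  have hsup : ∀ x ∈ Icc (0 : ℝ) 1, ‖v x - u x‖ ≤ η := fun x hx =>
    hw.norm_le_h1Norm (by simp [hv.2.1, hu.2.1]) hx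
  have hwi := (integrable_of_memLp_two hw.memLp_weakDeriv).norm
  have hUi := (integrable_of_memLp_two hu.1.memLp_weakDeriv).norm
  -- The factor `2` bounds both `1/‖v‖ ≤ 4/3` and `1/(‖u‖‖v‖) ≤ 16/9`.
  have hdiff : ‖∫ x, (weakDeriv v x / v x - weakDeriv u x / u x) ∂unitMeasure‖ ≤
      2 * (η * (1 + B)) := by
    calc ‖∫ x, (weakDeriv v x / v x - weakDeriv u x / u x) ∂unitMeasure‖
        ≤ ∫ x, (2 * ‖weakDeriv (fun x => v x - u x) x‖ + 2 * η * ‖weakDeriv u x‖) ∂unitMeasure := by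
          refine norm_integral_le_of_norm_le ((hwi.const_mul _).add (hUi.const_mul _)) ?_
          filter_upwards [weakDeriv_sub_ae hv.1 hu.1, ae_unitMeasure_iff.2 (ae_of_all _
            fun x (hx : x ∈ Ioo (0 : ℝ) 1) => Ioo_subset_Icc_self hx)] with x hx hxI
          rw [hx]
          have e : weakDeriv v x / v x - weakDeriv u x / u x =
              (weakDeriv v x - weakDeriv u x) / v x -
                weakDeriv u x * (v x - u x) / (u x * v x) := by
            have := hun x hxI
            have := hvn x hxI
            field_simp
            ring
          rw [e]
          refine (norm_sub_le _ _).trans (add_le_add ?_ ?_)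
          · rw [norm_div, div_le_iff₀ (by linarith [hv0 x hxI])]
            nlinarith [hv0 x hxI, norm_nonneg (weakDeriv v x - weakDeriv u x)]
          · rw [norm_div, norm_mul, norm_mul]
            have huv : 9 / 16 ≤ ‖u x‖ * ‖v x‖ := by nlinarith [hv0 x hxI, hu0 x hxI]
            rw [div_le_iff₀ (by linarith)]
            have h1 := hsup x hxI
            have h2 := norm_nonneg (weakDeriv u x)
            have h3 : ‖weakDeriv u x‖ * ‖v x - u x‖ ≤ ‖weakDeriv u x‖ * η :=
              mul_le_mul_of_nonneg_left h1 h2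
            nlinarith [mul_nonneg h2 hη]
      _ = 2 * (∫ x, ‖weakDeriv (fun x => v x - u x) x‖ ∂unitMeasure) + 2 * η * B := by
          rw [integral_add (hwi.const_mul _) (hUi.const_mul _), integral_const_mul,
            integral_const_mul]
      _ ≤ 2 * (η * (1 + B)) := by
          have := hw.integral_norm_weakDeriv_le
          linarith
  rw [integral_sub hvi hui, hm, hn] at hdiff
  -- Distinct quantized values are at least `2π` apart, so a gap below `2` forces equality.
  have hmn : ‖((m - n : ℤ) : ℂ) * (2 * Real.pi * Complex.I)‖ < 2 := by
    have e : ((m - n : ℤ) : ℂ) * (2 * Real.pi * Complex.I) =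
        Complex.I * α + m * (2 * Real.pi * Complex.I) -
          (Complex.I * α + n * (2 * Real.pi * Complex.I)) := by
      push_cast; ring
    rw [e]
    exact lt_of_le_of_lt hdiff (by linarith)
  have : m = n := by
    by_contra hne
    have h1 : (1 : ℝ) ≤ |((m - n : ℤ) : ℝ)| := by
      exact_mod_cast Int.one_le_abs (sub_ne_zero.2 hne)
    rw [norm_mul, Complex.norm_intCast] at hmn
    simp only [norm_mul, Complex.norm_ofNat, Complex.norm_real, Complex.norm_I, mul_one,
      Real.norm_eq_abs, abs_of_pos Real.pi_pos] at hmn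
    nlinarith [Real.pi_gt_three]
  rw [hm, hn, this]

theorem memLp_twist {v : ℝ → ℂ} (hv : MemH1 v) : MemLp (twist v) 2 unitMeasure := by
  obtain ⟨C, hC⟩ := isCompact_Icc.exists_bound_of_continuousOn hv.1
  have hg := hv.memLp_weakDeriv
  have hvm : AEStronglyMeasurable v unitMeasure := hv.2.1.1
  refine hg.of_le_mul (c := 2 * C) ?_ ?_
  · exact (hvm.re.mul hg.1.im).sub (hvm.im.mul hg.1.re)
  · refine ae_unitMeasure_iff.2 (ae_of_all _ fun x hx => ?_)
    have hx' := hC x (Ioo_subset_Icc_self hx)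
    have h1 := Complex.abs_re_le_norm (v x)
    have h2 := Complex.abs_im_le_norm (v x)
    have h3 := Complex.abs_re_le_norm (weakDeriv v x)
    have h4 := Complex.abs_im_le_norm (weakDeriv v x)
    have hC0 : 0 ≤ C := (norm_nonneg _).trans hx'
    rw [twist, Real.norm_eq_abs]
    refine (abs_sub _ _).trans ?_
    rw [abs_mul, abs_mul]
    calc _ ≤ C * ‖weakDeriv v x‖ + C * ‖weakDeriv v x‖ := by
            gcongr <;> linarith
      _ = _ := by ring

theorem integrable_energy_density {v : ℝ → ℂ} (hv : MemH1 v) (N : ℕ) (L ε : ℝ) :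
    Integrable (fun x => ε / 2 * ‖weakDeriv v x‖ ^ 2 + 1 / (4 * ε) * (‖v x‖ ^ 2 - 1) ^ 2
      + L / 2 * (twist v x - 2 * Real.pi * N) ^ 2) unitMeasure := by
  have h1 : Integrable (fun x => ‖weakDeriv v x‖ ^ 2) unitMeasure :=
    hv.memLp_weakDeriv.norm.integrable_sq
  have h2 : Integrable (fun x => (‖v x‖ ^ 2 - 1) ^ 2) unitMeasure :=
    integrable_of_memLp_two (memLp_unitMeasure_of_continuousOn
      (((hv.1.norm.pow 2).sub continuousOn_const).pow 2))
  have h3 : Integrable (fun x => (twist v x - 2 * Real.pi * N) ^ 2) unitMeasure :=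
    ((memLp_twist hv).sub (memLp_const _)).integrable_sq
  exact ((h1.const_mul _).add (h2.const_mul _)).add (h3.const_mul _)

/-! ### Twisted configurations in polar form -/

/-- The configuration `ρ e^{iθ}`. -/
noncomputable def polar (ρ θ : ℝ → ℝ) (x : ℝ) : ℂ := (ρ x : ℂ) * Complex.exp (Complex.I * (θ x : ℂ))

/-- The derivative of `ρ e^{iθ}`, where `ρ₁ = ρ'` and `q = θ'`. -/
noncomputable def polarDeriv (ρ ρ₁ θ q : ℝ → ℝ) (x : ℝ) : ℂ :=
  ((ρ₁ x : ℂ) + Complex.I * (ρ x * q x : ℝ)) * Complex.exp (Complex.I * (θ x : ℂ))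

theorem norm_polar (ρ θ : ℝ → ℝ) {x : ℝ} (h : 0 ≤ ρ x) : ‖polar ρ θ x‖ = ρ x := by
  rw [polar, norm_mul, Complex.norm_real, Real.norm_eq_abs, abs_of_nonneg h, mul_comm Complex.I,
    Complex.norm_exp_ofReal_mul_I, mul_one]

theorem norm_sq_polarDeriv (ρ ρ₁ θ q : ℝ → ℝ) (x : ℝ) :
    ‖polarDeriv ρ ρ₁ θ q x‖ ^ 2 = ρ₁ x ^ 2 + ρ x ^ 2 * q x ^ 2 := by
  rw [polarDeriv, norm_mul, mul_comm Complex.I (θ x : ℂ), Complex.norm_exp_ofReal_mul_I, mul_one,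
    ← Complex.normSq_eq_norm_sq, Complex.normSq_apply]
  simp
  ring

theorem polarDeriv_div_polar {ρ ρ₁ θ q : ℝ → ℝ} {x : ℝ} (h : ρ x ≠ 0) :
    polarDeriv ρ ρ₁ θ q x / polar ρ θ x = ((ρ₁ x / ρ x : ℝ) : ℂ) + Complex.I * (q x : ℝ) := by
  have h1 := Complex.exp_ne_zero (Complex.I * (θ x : ℂ))
  have h2 : (ρ x : ℂ) ≠ 0 := by exact_mod_cast h
  rw [polarDeriv, polar]
  push_cast
  field_simp

theorem twist_polar {ρ ρ₁ θ q : ℝ → ℝ} {x : ℝ} (h : 0 < ρ x) :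
    (polar ρ θ x).re * (polarDeriv ρ ρ₁ θ q x).im - (polar ρ θ x).im * (polarDeriv ρ ρ₁ θ q x).re =
      ρ x ^ 2 * q x := by
  have h1 := twist_div_eq_im (polar ρ θ x) (polarDeriv ρ ρ₁ θ q x)
  rw [polarDeriv_div_polar h.ne', norm_polar ρ θ h.le, div_eq_iff (by positivity)] at h1
  rw [h1]
  simp
  ring

theorem hasDerivAt_polar {ρ ρ₁ θ q : ℝ → ℝ} {x : ℝ} (h1 : HasDerivAt ρ (ρ₁ x) x)
    (h2 : HasDerivAt θ (q x) x) : HasDerivAt (polar ρ θ) (polarDeriv ρ ρ₁ θ q x) x := by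
  have h3 := h1.ofReal_comp.mul ((h2.ofReal_comp.const_mul Complex.I).cexp)
  refine HasDerivAt.congr_deriv h3 ?_
  rw [polarDeriv]
  push_cast
  ring

section

variable {ρ ρ₁ θ q : ℝ → ℝ}

theorem continuous_polarDeriv (hρ : ∀ x, HasDerivAt ρ (ρ₁ x) x) (hρ₁ : Continuous ρ₁)
    (hθ : ∀ x, HasDerivAt θ (q x) x) (hq : Continuous q) :
    Continuous (polarDeriv ρ ρ₁ θ q) := by
  have c1 : Continuous ρ := continuous_iff_continuousAt.2 fun x => (hρ x).continuousAt
  have c2 : Continuous θ := continuous_iff_continuousAt.2 fun x => (hθ x).continuousAt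
  unfold polarDeriv
  fun_prop

theorem polar_mem_admissible {α : ℝ} (hρ : ∀ x, HasDerivAt ρ (ρ₁ x) x) (hρ₁ : Continuous ρ₁)
    (hθ : ∀ x, HasDerivAt θ (q x) x) (hq : Continuous q) (hρ0 : ρ 0 = 1) (hρ1 : ρ 1 = 1)
    (hθ0 : θ 0 = 0) (hθ1 : Complex.exp (Complex.I * (θ 1 : ℂ)) = Complex.exp (Complex.I * α)) :
    polar ρ θ ∈ admissible α := by
  refine ⟨.of_hasDerivAt (fun x => hasDerivAt_polar (hρ x) (hθ x))
    (continuous_polarDeriv hρ hρ₁ hθ hq), ?_, ?_⟩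
  · simp [polar, hρ0, hθ0]
  · simp [polar, hρ1, hθ1]

theorem energy_polar (N : ℕ) (L ε : ℝ) (hρ : ∀ x, HasDerivAt ρ (ρ₁ x) x) (hρ₁ : Continuous ρ₁)
    (hθ : ∀ x, HasDerivAt θ (q x) x) (hq : Continuous q)
    (hpos : ∀ x ∈ Icc (0 : ℝ) 1, 0 < ρ x) :
    energy N L ε (polar ρ θ) = ∫ x, (ε / 2 * (ρ₁ x ^ 2 + ρ x ^ 2 * q x ^ 2) +
      1 / (4 * ε) * (ρ x ^ 2 - 1) ^ 2 + L / 2 * (ρ x ^ 2 * q x - 2 * Real.pi * N) ^ 2)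
        ∂unitMeasure := by
  refine integral_congr_ae ?_
  filter_upwards [weakDeriv_ae_eq_of_hasDerivAt (fun x => hasDerivAt_polar (hρ x) (hθ x))
    (continuous_polarDeriv hρ hρ₁ hθ hq), ae_unitMeasure_iff.2 (ae_of_all _
      fun x (hx : x ∈ Ioo (0 : ℝ) 1) => Ioo_subset_Icc_self hx)] with x hx hxI
  rw [twist, hx, twist_polar (hpos x hxI), norm_sq_polarDeriv, norm_polar ρ θ (hpos x hxI).le]

theorem integral_log_deriv_polar_im (hρ : ∀ x, HasDerivAt ρ (ρ₁ x) x) (hρ₁ : Continuous ρ₁)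
    (hθ : ∀ x, HasDerivAt θ (q x) x) (hq : Continuous q)
    (hpos : ∀ x ∈ Icc (0 : ℝ) 1, 0 < ρ x)
    (hi : Integrable (fun x => weakDeriv (polar ρ θ) x / polar ρ θ x) unitMeasure) :
    (∫ x, weakDeriv (polar ρ θ) x / polar ρ θ x ∂unitMeasure).im = ∫ x, q x ∂unitMeasure := by
  have := Complex.imCLM.integral_comp_comm hi
  simp only [Complex.imCLM_apply] at this
  rw [← this]
  refine integral_congr_ae ?_
  filter_upwards [weakDeriv_ae_eq_of_hasDerivAt (fun x => hasDerivAt_polar (hρ x) (hθ x))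
    (continuous_polarDeriv hρ hρ₁ hθ hq), ae_unitMeasure_iff.2 (ae_of_all _
      fun x (hx : x ∈ Ioo (0 : ℝ) 1) => Ioo_subset_Icc_self hx)] with x hx hxI
  rw [hx, polarDeriv_div_polar (hpos x hxI).ne']
  simp

/-- A solution of the Euler-Lagrange system with modulus close to one is an `H¹`-local minimizer
once `ε` is small compared with the Lagrange multiplier. -/
theorem polar_isH1LocalMinimizer {ρ₂ : ℝ → ℝ} {N : ℕ} {L ε α l K : ℝ} (hL : 0 < L) (hε : 0 < ε)
    (hρ : ∀ x, HasDerivAt ρ (ρ₁ x) x) (hρ₁ : ∀ x, HasDerivAt ρ₁ (ρ₂ x) x) (hρ₂ : Continuous ρ₂)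
    (hθ : ∀ x, HasDerivAt θ (q x) x) (hq : Continuous q) (hρ0 : ρ 0 = 1) (hρ1 : ρ 1 = 1)
    (hθ0 : θ 0 = 0) (hθ1 : Complex.exp (Complex.I * (θ 1 : ℂ)) = Complex.exp (Complex.I * α))
    (hclose : ∀ x ∈ Icc (0 : ℝ) 1, |ρ x - 1| ≤ 1 / 8)
    (hl : ∀ x ∈ Icc (0 : ℝ) 1,
      l = ε * (ρ x ^ 2 * q x) + L * ρ x ^ 2 * (ρ x ^ 2 * q x - 2 * Real.pi * N))
    (hK1 : ∀ x ∈ Icc (0 : ℝ) 1, |ε * (ρ x ^ 2 * q x) - l| ≤ K)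
    (hK2 : ∀ x ∈ Icc (0 : ℝ) 1,
      |ε * (ρ x ^ 2 * q x) ^ 2 / 2 - l * (ρ x ^ 2 * q x)| ≤ K)
    (hK : 16 * K + 32 * K ^ 2 / L ≤ 1 / (4 * ε))
    (hode : ∀ x ∈ Icc (0 : ℝ) 1, ε * ρ₂ x = ρ x * (ρ x ^ 2 - 1) / ε -
      (ε * (ρ x ^ 2 * q x) ^ 2 - 2 * l * (ρ x ^ 2 * q x)) / ρ x ^ 3) :
    IsH1LocalMinimizer (energy N L ε) (admissible α) (polar ρ θ) := by
  have cρ₁ : Continuous ρ₁ := continuous_iff_continuousAt.2 fun x => (hρ₁ x).continuousAt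
  have cρ : Continuous ρ := continuous_iff_continuousAt.2 fun x => (hρ x).continuousAt
  have hu := polar_mem_admissible (α := α) hρ cρ₁ hθ hq hρ0 hρ1 hθ0 hθ1
  have hpos : ∀ x ∈ Icc (0 : ℝ) 1, 0 < ρ x := fun x hx => by
    have := abs_le.1 (hclose x hx); linarith
  set u := polar ρ θ with hu_def
  have hun : ∀ x ∈ Icc (0 : ℝ) 1, ‖u x‖ = ρ x := fun x hx => norm_polar ρ θ (hpos x hx).le
  set B := ∫ x, ‖weakDeriv u x‖ ∂unitMeasure with hB
  have hB0 : 0 ≤ B := integral_nonneg fun x => norm_nonneg _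
  -- With `ρ` within `1/8` of one, a radius of `1/8` keeps `‖v‖` in `[3/4, 5/4]`; the bound
  -- `1/(1+B)` preserves the winding.
  refine ⟨hu, min (1 / 8) (1 / (1 + B)), by positivity, fun v hv hlt => ?_⟩
  have hlt1 := hlt.trans_le (min_le_left _ _)
  have hlt2 := hlt.trans_le (min_le_right _ _)
  rw [lt_div_iff₀ (by positivity)] at hlt2
  have hvu : ∀ x ∈ Icc (0 : ℝ) 1, ‖v x‖ ∈ Icc (3 / 4 : ℝ) (5 / 4) := fun x hx => by
    have h1 := ((hv.1.sub hu.1).norm_le_h1Norm (by simp [hv.2.1, hu.2.1]) hx).trans hlt1.le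
    have h2 := abs_le.1 ((abs_norm_sub_norm_le _ _).trans h1)
    rw [hun x hx] at h2
    have h3 := abs_le.1 (hclose x hx)
    constructor <;> linarith [h2.1, h2.2, h3.1, h3.2]
  have hvn : ∀ x ∈ Icc (0 : ℝ) 1, v x ≠ 0 := fun x hx => norm_pos_iff.1 (by linarith [(hvu x hx).1])
  have hwind := integral_log_deriv_eq_of_close hu hv
    (fun x hx => by rw [hun x hx]; linarith [(abs_le.1 (hclose x hx)).1])
    (fun x hx => (hvu x hx).1) hlt2
  have hui := (exists_int_integral_log_deriv hu fun x hx =>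
    norm_pos_iff.1 (by rw [hun x hx]; exact hpos x hx)).1
  have hvi := (exists_int_integral_log_deriv hv hvn).1
  have hwind' : ∫ x, (weakDeriv v x / v x).im ∂unitMeasure = ∫ x, q x ∂unitMeasure := by
    rw [← integral_log_deriv_polar_im hρ cρ₁ hθ hq hpos hui, ← hu_def, ← hwind]
    exact Complex.imCLM.integral_comp_comm hvi
  set D : ℝ → ℝ := fun x => ε / 2 * (ρ₁ x ^ 2 + ρ x ^ 2 * q x ^ 2) +
      1 / (4 * ε) * (ρ x ^ 2 - 1) ^ 2 + L / 2 * (ρ x ^ 2 * q x - 2 * Real.pi * N) ^ 2 with hD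
  set r : ℝ → ℝ := fun x => inner ℝ (v x) (weakDeriv v x) / ‖v x‖ with hr
  have iD : Integrable D unitMeasure := by
    refine integrable_unitMeasure_iff.2 (Continuous.intervalIntegrable ?_ _ _)
    fun_prop
  have iq : Integrable q unitMeasure := integrable_unitMeasure_iff.2 (hq.intervalIntegrable _ _)
  have ir : Integrable r unitMeasure := by
    have hg := hv.1.memLp_weakDeriv
    refine (integrable_of_memLp_two hg).norm.mono' ?_ ?_
    · exact (AEStronglyMeasurable.inner hv.1.2.1.1 hg.1).div₀ hv.1.2.1.1.norm
    · refine ae_of_all _ fun x => ?_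
      rw [hr, Real.norm_eq_abs, abs_div, abs_norm]
      refine div_le_of_le_mul₀ (norm_nonneg _) (norm_nonneg _) ?_
      rw [mul_comm]
      exact abs_real_inner_le_norm _ _
  have iA : Integrable (fun x => ρ₂ x * ‖v x‖ + ρ₁ x * r x) unitMeasure := by
    refine Integrable.add (integrable_of_memLp_two (memLp_unitMeasure_of_continuousOn
      (hρ₂.continuousOn.mul hv.1.1.norm))) ?_
    exact integrable_unitMeasure_iff.2 ((integrable_unitMeasure_iff.1 ir).continuousOn_mul
      cρ₁.continuousOn)
  have iB : Integrable (fun x => ρ₂ x * ρ x + ρ₁ x * ρ₁ x) unitMeasure :=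
    integrable_unitMeasure_iff.2 (((hρ₂.mul cρ).add (cρ₁.mul cρ₁)).intervalIntegrable _ _)
  have ivim : Integrable (fun x => (weakDeriv v x / v x).im) unitMeasure := hvi.im
  have eA : ∫ x, (ρ₂ x * ‖v x‖ + ρ₁ x * r x) ∂unitMeasure = ρ₁ 1 - ρ₁ 0 := by
    rw [integral_unitMeasure, hv.1.integral_norm_by_parts hvn hρ₁ hρ₂, hv.2.1, hv.2.2,
      mul_comm Complex.I, Complex.norm_exp_ofReal_mul_I, norm_one, mul_one, mul_one]
  have eB : ∫ x, (ρ₂ x * ρ x + ρ₁ x * ρ₁ x) ∂unitMeasure = ρ₁ 1 - ρ₁ 0 := by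
    rw [integral_unitMeasure, intervalIntegral.integral_eq_sub_of_hasDerivAt
      (f := fun x => ρ₁ x * ρ x) (fun x _ => (hρ₁ x).fun_mul (hρ x))
      (integrable_unitMeasure_iff.1 iB), hρ0, hρ1, mul_one, mul_one]
  -- Both added terms have zero integral: the first by equality of windings, the second because
  -- `‖v‖` and `ρ` equal one at both endpoints. The energy comparison thereby becomes pointwise.
  have e1 : energy N L ε u = ∫ x, (D x + l * ((weakDeriv v x / v x).im - q x) +
      ε * ((ρ₂ x * ‖v x‖ + ρ₁ x * r x) - (ρ₂ x * ρ x + ρ₁ x * ρ₁ x))) ∂unitMeasure := by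
    have j1 : Integrable (fun x => l * ((weakDeriv v x / v x).im - q x)) unitMeasure :=
      (ivim.sub iq).const_mul _
    have j2 : Integrable (fun x => ε * ((ρ₂ x * ‖v x‖ + ρ₁ x * r x) -
      (ρ₂ x * ρ x + ρ₁ x * ρ₁ x))) unitMeasure := (iA.sub iB).const_mul _
    have j3 : Integrable (fun x => D x + l * ((weakDeriv v x / v x).im - q x)) unitMeasure :=
      iD.add j1
    rw [integral_add j3 j2, integral_add iD j1, integral_const_mul, integral_const_mul,
      integral_sub ivim iq, integral_sub iA iB, eA, eB, hwind',
      energy_polar N L ε hρ cρ₁ hθ hq hpos]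
    simp [hD]
  rw [e1]
  refine integral_mono_ae ((iD.add ((ivim.sub iq).const_mul _)).add ((iA.sub iB).const_mul _))
    (integrable_energy_density hv.1 N L ε) ?_
  refine ae_unitMeasure_iff.2 (ae_of_all _ fun x hx => ?_)
  have hxI := Ioo_subset_Icc_self hx
  have hρx := hpos x hxI
  have hc := abs_le.1 (hclose x hxI)
  have key := lagrangian_density_ge (p := twist v x) hε hL (hvu x hxI)
    ⟨by linarith [hc.1], by linarith [hc.2]⟩ (hl x hxI) (hK1 x hxI) (hK2 x hxI) hK
  -- The radial equation turns the coefficient of `‖v‖ - ρ` into `ερ''`; what then remains to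
  -- compare is the nonnegative square `(ε/2)(r - ρ')²`.
  rw [← hode x hxI] at key
  have hn := norm_sq_eq_radial_add_twist (g := weakDeriv v x) (hvn x hxI)
  change ‖weakDeriv v x‖ ^ 2 = r x ^ 2 + twist v x ^ 2 / ‖v x‖ ^ 2 at hn
  have him : (weakDeriv v x / v x).im = twist v x / ‖v x‖ ^ 2 := (twist_div_eq_im _ _).symm
  have f1 : (ρ x ^ 2 * q x) ^ 2 / ρ x ^ 2 = ρ x ^ 2 * q x ^ 2 := by field_simp
  have f2 : ρ x ^ 2 * q x / ρ x ^ 2 = q x := by field_simp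
  rw [f1, f2] at key
  simp only [hD]
  rw [hn, him]
  nlinarith [mul_nonneg hε.le (sq_nonneg (r x - ρ₁ x))]

end

/-! ### The Dirichlet Green operator of `-d²/dx² + k²` -/

/-- The solution of `-s'' + k² s = f`, `s(0) = s(1) = 0`. -/
noncomputable def green (k : ℝ) (f : ℝ → ℝ) (x : ℝ) : ℝ :=
  (Real.sinh (k * x) * (∫ y in x..1, Real.sinh (k * (1 - y)) * f y) +
    Real.sinh (k * (1 - x)) * ∫ y in (0 : ℝ)..x, Real.sinh (k * y) * f y) / (k * Real.sinh k)

/-- The derivative of `green k f`. -/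
noncomputable def greenDeriv (k : ℝ) (f : ℝ → ℝ) (x : ℝ) : ℝ :=
  (Real.cosh (k * x) * (∫ y in x..1, Real.sinh (k * (1 - y)) * f y) -
    Real.cosh (k * (1 - x)) * ∫ y in (0 : ℝ)..x, Real.sinh (k * y) * f y) / Real.sinh k

theorem green_zero (k : ℝ) (f : ℝ → ℝ) : green k f 0 = 0 := by simp [green]

theorem green_one (k : ℝ) (f : ℝ → ℝ) : green k f 1 = 0 := by simp [green]

section

variable {k : ℝ} {f : ℝ → ℝ}

theorem hasDerivAt_integral_left (hf : Continuous f) (x : ℝ) :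
    HasDerivAt (fun x => ∫ y in x..1, Real.sinh (k * (1 - y)) * f y)
      (-(Real.sinh (k * (1 - x)) * f x)) x := by
  have hc : Continuous fun y => Real.sinh (k * (1 - y)) * f y :=
    (Real.continuous_sinh.comp (by fun_prop)).mul hf
  exact intervalIntegral.integral_hasDerivAt_left (hc.intervalIntegrable _ _)
    hc.stronglyMeasurable.stronglyMeasurableAtFilter hc.continuousAt

theorem hasDerivAt_integral_right (hf : Continuous f) (x : ℝ) :
    HasDerivAt (fun x => ∫ y in (0 : ℝ)..x, Real.sinh (k * y) * f y)
      (Real.sinh (k * x) * f x) x := by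
  have hc : Continuous fun y => Real.sinh (k * y) * f y :=
    (Real.continuous_sinh.comp (by fun_prop)).mul hf
  exact intervalIntegral.integral_hasDerivAt_right (hc.intervalIntegrable _ _)
    hc.stronglyMeasurable.stronglyMeasurableAtFilter hc.continuousAt

theorem hasDerivAt_mul_left (k x : ℝ) : HasDerivAt (fun x => k * x) k x := by
  simpa using (hasDerivAt_id x).const_mul k

theorem hasDerivAt_mul_one_sub (k x : ℝ) : HasDerivAt (fun x => k * (1 - x)) (-k) x := by
  simpa using ((hasDerivAt_id x).const_sub 1).const_mul k

theorem hasDerivAt_green (hk : 0 < k) (hf : Continuous f) (x : ℝ) :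
    HasDerivAt (green k f) (greenDeriv k f x) x := by
  have hs : Real.sinh k ≠ 0 := (Real.sinh_pos_iff.2 hk).ne'
  have h := (((hasDerivAt_mul_left k x).sinh.mul (hasDerivAt_integral_left (k := k) hf x)).add
    ((hasDerivAt_mul_one_sub k x).sinh.mul (hasDerivAt_integral_right (k := k) hf x))).div_const
      (k * Real.sinh k)
  refine HasDerivAt.congr_deriv h ?_
  rw [greenDeriv]
  field_simp
  ring

theorem hasDerivAt_greenDeriv (hk : 0 < k) (hf : Continuous f) (x : ℝ) :
    HasDerivAt (greenDeriv k f) (k ^ 2 * green k f x - f x) x := by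
  have hs : Real.sinh k ≠ 0 := (Real.sinh_pos_iff.2 hk).ne'
  have h := (((hasDerivAt_mul_left k x).cosh.mul (hasDerivAt_integral_left (k := k) hf x)).sub
    ((hasDerivAt_mul_one_sub k x).cosh.mul (hasDerivAt_integral_right (k := k) hf x))).div_const
      (Real.sinh k)
  refine HasDerivAt.congr_deriv h ?_
  have e : Real.sinh k = Real.sinh (k * x) * Real.cosh (k * (1 - x)) +
      Real.cosh (k * x) * Real.sinh (k * (1 - x)) := by
    rw [← Real.sinh_add]; congr 1; ring
  rw [green]
  field_simp
  rw [e]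
  ring

theorem integral_sinh_left (hk : 0 < k) (x : ℝ) :
    ∫ y in x..1, Real.sinh (k * (1 - y)) = (Real.cosh (k * (1 - x)) - 1) / k := by
  have hc : Continuous fun y => Real.sinh (k * (1 - y)) := Real.continuous_sinh.comp (by fun_prop)
  rw [intervalIntegral.integral_eq_sub_of_hasDerivAt (f := fun y => -(Real.cosh (k * (1 - y)) / k))
    (fun y _ => HasDerivAt.congr_deriv ((hasDerivAt_mul_one_sub k y).cosh.div_const k).neg
      (by field_simp))
    (hc.intervalIntegrable _ _)]
  simp only [sub_self, mul_zero, Real.cosh_zero]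
  ring

theorem integral_sinh_right (hk : 0 < k) (x : ℝ) :
    ∫ y in (0 : ℝ)..x, Real.sinh (k * y) = (Real.cosh (k * x) - 1) / k := by
  have hc : Continuous fun y => Real.sinh (k * y) := Real.continuous_sinh.comp (by fun_prop)
  rw [intervalIntegral.integral_eq_sub_of_hasDerivAt (f := fun y => Real.cosh (k * y) / k)
    (fun y _ => HasDerivAt.congr_deriv ((hasDerivAt_mul_left k y).cosh.div_const k)
      (by field_simp))
    (hc.intervalIntegrable _ _)]
  simp only [mul_zero, Real.cosh_zero]
  ring

theorem abs_integral_left_le (hk : 0 < k) {C : ℝ}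
    (hC : ∀ x ∈ Icc (0 : ℝ) 1, |f x| ≤ C) {x : ℝ} (hx : x ∈ Icc (0 : ℝ) 1) :
    |∫ y in x..1, Real.sinh (k * (1 - y)) * f y| ≤ C * ((Real.cosh (k * (1 - x)) - 1) / k) := by
  rw [← integral_sinh_left hk, ← intervalIntegral.integral_const_mul, ← Real.norm_eq_abs]
  refine intervalIntegral.norm_integral_le_of_norm_le hx.2 (ae_of_all _ fun y hy => ?_)
    ((continuous_const.mul (Real.continuous_sinh.comp (by fun_prop))).intervalIntegrable _ _)
  have hs : 0 ≤ Real.sinh (k * (1 - y)) :=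
    Real.sinh_nonneg_iff.2 (mul_nonneg hk.le (by linarith [hy.2]))
  rw [norm_mul, Real.norm_eq_abs, Real.norm_eq_abs, abs_of_nonneg hs, mul_comm]
  exact mul_le_mul_of_nonneg_right (hC y ⟨by linarith [hx.1, hy.1], hy.2⟩) hs

theorem abs_integral_right_le (hk : 0 < k) {C : ℝ}
    (hC : ∀ x ∈ Icc (0 : ℝ) 1, |f x| ≤ C) {x : ℝ} (hx : x ∈ Icc (0 : ℝ) 1) :
    |∫ y in (0 : ℝ)..x, Real.sinh (k * y) * f y| ≤ C * ((Real.cosh (k * x) - 1) / k) := by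
  rw [← integral_sinh_right hk, ← intervalIntegral.integral_const_mul, ← Real.norm_eq_abs]
  refine intervalIntegral.norm_integral_le_of_norm_le hx.1 (ae_of_all _ fun y hy => ?_)
    ((continuous_const.mul (Real.continuous_sinh.comp (by fun_prop))).intervalIntegrable _ _)
  have hs : 0 ≤ Real.sinh (k * y) := Real.sinh_nonneg_iff.2 (mul_nonneg hk.le hy.1.le)
  rw [norm_mul, Real.norm_eq_abs, Real.norm_eq_abs, abs_of_nonneg hs, mul_comm]
  exact mul_le_mul_of_nonneg_right (hC y ⟨hy.1.le, hy.2.trans hx.2⟩) hs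

/-- The kernel is nonnegative, so the extreme case is constant `f`, for which the solution is
explicit and below `C / k²`. -/
theorem abs_green_le (hk : 0 < k) {C : ℝ} (hC : ∀ x ∈ Icc (0 : ℝ) 1, |f x| ≤ C) {x : ℝ}
    (hx : x ∈ Icc (0 : ℝ) 1) : |green k f x| ≤ C / k ^ 2 := by
  have hC0 : 0 ≤ C := (abs_nonneg _).trans (hC x hx)
  have hs : 0 < Real.sinh k := Real.sinh_pos_iff.2 hk
  have h1 : 0 ≤ Real.sinh (k * x) := Real.sinh_nonneg_iff.2 (mul_nonneg hk.le hx.1)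
  have h2 : 0 ≤ Real.sinh (k * (1 - x)) :=
    Real.sinh_nonneg_iff.2 (mul_nonneg hk.le (by linarith [hx.2]))
  have e : Real.sinh k = Real.sinh (k * x) * Real.cosh (k * (1 - x)) +
      Real.cosh (k * x) * Real.sinh (k * (1 - x)) := by
    rw [← Real.sinh_add]; congr 1; ring
  rw [green, abs_div, abs_of_pos (mul_pos hk hs), div_le_iff₀ (mul_pos hk hs)]
  refine (abs_add_le _ _).trans ?_
  rw [abs_mul, abs_mul, abs_of_nonneg h1, abs_of_nonneg h2]
  calc _ ≤ Real.sinh (k * x) * (C * ((Real.cosh (k * (1 - x)) - 1) / k)) +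
        Real.sinh (k * (1 - x)) * (C * ((Real.cosh (k * x) - 1) / k)) :=
        add_le_add (mul_le_mul_of_nonneg_left (abs_integral_left_le hk hC hx) h1)
          (mul_le_mul_of_nonneg_left (abs_integral_right_le hk hC hx) h2)
    _ = C / k * (Real.sinh k - Real.sinh (k * x) - Real.sinh (k * (1 - x))) := by
        rw [e]; ring
    _ ≤ C / k * Real.sinh k := mul_le_mul_of_nonneg_left (by linarith) (by positivity)
    _ = C / k ^ 2 * (k * Real.sinh k) := by field_simp

theorem cosh_le_two_mul_sinh (hk : 1 ≤ k) : Real.cosh k ≤ 2 * Real.sinh k := by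
  rw [Real.cosh_eq, Real.sinh_eq]
  have h1 : 2 ≤ Real.exp k := by linarith [Real.add_one_le_exp k]
  have h2 : Real.exp (-k) * Real.exp k = 1 := by rw [← Real.exp_add]; simp
  have h3 := Real.exp_pos (-k)
  nlinarith

/-- The same integrals give `2 cosh k / sinh k`, and `k ≥ 1` makes this at most `4`. -/
theorem abs_greenDeriv_le (hk : 1 ≤ k) {C : ℝ} (hC : ∀ x ∈ Icc (0 : ℝ) 1, |f x| ≤ C) {x : ℝ}
    (hx : x ∈ Icc (0 : ℝ) 1) : |greenDeriv k f x| ≤ 4 * C / k := by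
  have hC0 : 0 ≤ C := (abs_nonneg _).trans (hC x hx)
  have hk0 : 0 < k := by linarith
  have hs : 0 < Real.sinh k := Real.sinh_pos_iff.2 hk0
  have h1 : 0 ≤ Real.sinh (k * x) := Real.sinh_nonneg_iff.2 (mul_nonneg hk0.le hx.1)
  have h2 : 0 ≤ Real.sinh (k * (1 - x)) :=
    Real.sinh_nonneg_iff.2 (mul_nonneg hk0.le (by linarith [hx.2]))
  have e : Real.cosh k = Real.cosh (k * x) * Real.cosh (k * (1 - x)) +
      Real.sinh (k * x) * Real.sinh (k * (1 - x)) := by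
    rw [← Real.cosh_add]; congr 1; ring
  have c1 := Real.cosh_pos (k * x)
  have c2 := Real.cosh_pos (k * (1 - x))
  have hcs := cosh_le_two_mul_sinh hk
  rw [greenDeriv, abs_div, abs_of_pos hs, div_le_iff₀ hs]
  refine (abs_sub _ _).trans ?_
  rw [abs_mul, abs_mul, abs_of_pos c1, abs_of_pos c2]
  calc _ ≤ Real.cosh (k * x) * (C * ((Real.cosh (k * (1 - x)) - 1) / k)) +
        Real.cosh (k * (1 - x)) * (C * ((Real.cosh (k * x) - 1) / k)) :=
        add_le_add (mul_le_mul_of_nonneg_left (abs_integral_left_le hk0 hC hx) c1.le)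
          (mul_le_mul_of_nonneg_left (abs_integral_right_le hk0 hC hx) c2.le)
    _ = C / k * (2 * (Real.cosh (k * x) * Real.cosh (k * (1 - x))) - Real.cosh (k * x) -
          Real.cosh (k * (1 - x))) := by ring
    _ ≤ C / k * (4 * Real.sinh k) := by
        refine mul_le_mul_of_nonneg_left ?_ (by positivity)
        nlinarith [mul_nonneg h1 h2]
    _ = 4 * C / k * Real.sinh k := by ring

theorem green_sub {g : ℝ → ℝ} (hf : Continuous f) (hg : Continuous g) (x : ℝ) :
    green k f x - green k g x = green k (fun y => f y - g y) x := by
  have c1 : Continuous fun y => Real.sinh (k * (1 - y)) := Real.continuous_sinh.comp (by fun_prop)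
  have c2 : Continuous fun y => Real.sinh (k * y) := Real.continuous_sinh.comp (by fun_prop)
  have e1 : ∫ y in x..1, Real.sinh (k * (1 - y)) * (f y - g y) =
      (∫ y in x..1, Real.sinh (k * (1 - y)) * f y) -
        ∫ y in x..1, Real.sinh (k * (1 - y)) * g y := by
    simp_rw [mul_sub (Real.sinh _)]
    exact intervalIntegral.integral_sub ((c1.mul hf).intervalIntegrable _ _)
      ((c1.mul hg).intervalIntegrable _ _)
  have e2 : ∫ y in (0 : ℝ)..x, Real.sinh (k * y) * (f y - g y) =
      (∫ y in (0 : ℝ)..x, Real.sinh (k * y) * f y) -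
        ∫ y in (0 : ℝ)..x, Real.sinh (k * y) * g y := by
    simp_rw [mul_sub (Real.sinh _)]
    exact intervalIntegral.integral_sub ((c2.mul hf).intervalIntegrable _ _)
      ((c2.mul hg).intervalIntegrable _ _)
  rw [green, green, green, e1, e2]
  ring

theorem continuous_green (hk : 0 < k) (hf : Continuous f) : Continuous (green k f) :=
  continuous_iff_continuousAt.2 fun x => (hasDerivAt_green hk hf x).continuousAt

end

/-! ### Uniformly Lipschitz families of functionals -/

/-- The extension of `σ ∈ C([0,1])` to the line by constants. -/
noncomputable def ext (σ : C(Icc (0 : ℝ) 1, ℝ)) : ℝ → ℝ := IccExtend zero_le_one σ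

theorem continuous_ext (σ : C(Icc (0 : ℝ) 1, ℝ)) : Continuous (ext σ) := σ.continuous.Icc_extend'

theorem abs_ext_le (σ : C(Icc (0 : ℝ) 1, ℝ)) (x : ℝ) : |ext σ x| ≤ ‖σ‖ := σ.norm_coe_le_norm _

theorem abs_ext_sub_le (σ τ : C(Icc (0 : ℝ) 1, ℝ)) (x : ℝ) : |ext σ x - ext τ x| ≤ ‖σ - τ‖ :=
  (σ - τ).norm_coe_le_norm _

/-- `Φ ε` is bounded and Lipschitz on the ball of radius `1/16`, uniformly in `ε ∈ (0,1]`. -/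
def UnifLip (Φ : ℝ → C(Icc (0 : ℝ) 1, ℝ) → ℝ → ℝ) : Prop :=
  (∃ K, 0 ≤ K ∧ ∀ ε ∈ Ioc (0 : ℝ) 1, ∀ σ τ : C(Icc (0 : ℝ) 1, ℝ), ‖σ‖ ≤ 1 / 16 → ‖τ‖ ≤ 1 / 16 →
    ∀ x, |Φ ε σ x| ≤ K ∧ |Φ ε σ x - Φ ε τ x| ≤ K * ‖σ - τ‖) ∧
  ∀ ε ∈ Ioc (0 : ℝ) 1, ∀ σ : C(Icc (0 : ℝ) 1, ℝ), ‖σ‖ ≤ 1 / 16 → Continuous (Φ ε σ)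

namespace UnifLip

variable {Φ Ψ : ℝ → C(Icc (0 : ℝ) 1, ℝ) → ℝ → ℝ}

theorem const (c : ℝ) : UnifLip fun _ _ _ => c :=
  ⟨⟨|c|, abs_nonneg _, fun _ _ σ τ _ _ _ => ⟨le_rfl, by simp; positivity⟩⟩,
    fun _ _ _ _ => continuous_const⟩

theorem param : UnifLip fun ε _ _ => ε :=
  ⟨⟨1, zero_le_one, fun ε hε σ τ _ _ _ => ⟨abs_le.2 ⟨by linarith [hε.1], hε.2⟩, by simp⟩⟩,
    fun _ _ _ _ => continuous_const⟩

theorem eval : UnifLip fun _ σ => ext σ :=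
  ⟨⟨1, zero_le_one, fun _ _ σ τ h _ x => ⟨(abs_ext_le σ x).trans (by linarith),
    by simpa using abs_ext_sub_le σ τ x⟩⟩, fun _ _ σ _ => continuous_ext σ⟩

theorem add (h : UnifLip Φ) (h' : UnifLip Ψ) : UnifLip fun ε σ x => Φ ε σ x + Ψ ε σ x := by
  obtain ⟨⟨K, hK, hb⟩, hc⟩ := h
  obtain ⟨⟨K', hK', hb'⟩, hc'⟩ := h'
  refine ⟨⟨K + K', by positivity, fun ε hε σ τ hσ hτ x => ?_⟩,
    fun ε hε σ hσ => (hc ε hε σ hσ).add (hc' ε hε σ hσ)⟩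
  obtain ⟨h1, h2⟩ := hb ε hε σ τ hσ hτ x
  obtain ⟨h3, h4⟩ := hb' ε hε σ τ hσ hτ x
  refine ⟨(abs_add_le _ _).trans (add_le_add h1 h3), ?_⟩
  rw [add_sub_add_comm, add_mul]
  exact (abs_add_le _ _).trans (add_le_add h2 h4)

theorem mul (h : UnifLip Φ) (h' : UnifLip Ψ) : UnifLip fun ε σ x => Φ ε σ x * Ψ ε σ x := by
  obtain ⟨⟨K, hK, hb⟩, hc⟩ := h
  obtain ⟨⟨K', hK', hb'⟩, hc'⟩ := h'
  refine ⟨⟨2 * (K * K') + K * K', by positivity, fun ε hε σ τ hσ hτ x => ?_⟩,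
    fun ε hε σ hσ => (hc ε hε σ hσ).mul (hc' ε hε σ hσ)⟩
  obtain ⟨h1, h2⟩ := hb ε hε σ τ hσ hτ x
  obtain ⟨h3, h4⟩ := hb' ε hε σ τ hσ hτ x
  have h5 := (hb ε hε τ σ hτ hσ x).1
  have hKK := mul_nonneg hK hK'
  constructor
  · rw [abs_mul]
    have : |Φ ε σ x| * |Ψ ε σ x| ≤ K * K' := by gcongr
    linarith
  · have e : Φ ε σ x * Ψ ε σ x - Φ ε τ x * Ψ ε τ x =
        (Φ ε σ x - Φ ε τ x) * Ψ ε σ x + Φ ε τ x * (Ψ ε σ x - Ψ ε τ x) := by ring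
    rw [e]
    refine (abs_add_le _ _).trans ?_
    rw [abs_mul, abs_mul]
    calc _ ≤ K * ‖σ - τ‖ * K' + K * (K' * ‖σ - τ‖) := by gcongr
      _ = 2 * (K * K') * ‖σ - τ‖ := by ring
      _ ≤ _ := mul_le_mul_of_nonneg_right (by linarith) (norm_nonneg _)

theorem sub (h : UnifLip Φ) (h' : UnifLip Ψ) : UnifLip fun ε σ x => Φ ε σ x - Ψ ε σ x := by
  have := h.add ((const (-1)).mul h')
  simpa only [neg_one_mul, ← sub_eq_add_neg] using this

theorem pow (h : UnifLip Φ) (n : ℕ) : UnifLip fun ε σ x => Φ ε σ x ^ n := by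
  induction n with
  | zero => simpa using const 1
  | succ n ih => simpa only [pow_succ] using ih.mul h

theorem inv (h : UnifLip Φ) {c : ℝ} (hc : 0 < c) (hlow : ∀ ε ∈ Ioc (0 : ℝ) 1,
    ∀ σ : C(Icc (0 : ℝ) 1, ℝ), ‖σ‖ ≤ 1 / 16 → ∀ x, c ≤ Φ ε σ x) :
    UnifLip fun ε σ x => (Φ ε σ x)⁻¹ := by
  obtain ⟨⟨K, hK, hb⟩, hcont⟩ := h
  refine ⟨⟨c⁻¹ + K * (c⁻¹ * c⁻¹), by positivity, fun ε hε σ τ hσ hτ x => ?_⟩,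
    fun ε hε σ hσ => (hcont ε hε σ hσ).inv₀ fun x => (hc.trans_le (hlow ε hε σ hσ x)).ne'⟩
  have h1 := hlow ε hε σ hσ x
  have h2 := hlow ε hε τ hτ x
  have h1' := hc.trans_le h1
  have h2' := hc.trans_le h2
  have i1 : (Φ ε σ x)⁻¹ ≤ c⁻¹ := inv_anti₀ hc h1
  have i2 : (Φ ε τ x)⁻¹ ≤ c⁻¹ := inv_anti₀ hc h2
  have hc' : 0 < c⁻¹ := inv_pos.2 hc
  constructor
  · rw [abs_of_pos (inv_pos.2 h1')]
    have : 0 ≤ K * (c⁻¹ * c⁻¹) := by positivity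
    linarith
  · have e : (Φ ε σ x)⁻¹ - (Φ ε τ x)⁻¹ =
        -(Φ ε σ x - Φ ε τ x) * ((Φ ε σ x)⁻¹ * (Φ ε τ x)⁻¹) := by
      field_simp; ring
    rw [e, abs_mul, abs_neg, abs_of_pos (mul_pos (inv_pos.2 h1') (inv_pos.2 h2'))]
    calc _ ≤ K * ‖σ - τ‖ * (c⁻¹ * c⁻¹) := by
          gcongr
          exact (hb ε hε σ τ hσ hτ x).2
      _ = K * (c⁻¹ * c⁻¹) * ‖σ - τ‖ := by ring
      _ ≤ _ := mul_le_mul_of_nonneg_right (by linarith) (norm_nonneg _)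

/-- Together with the algebraic closure rules, this covers the nonlocal multiplier, which involves
`σ` only through integrals. -/
theorem integral (h : UnifLip Φ) : UnifLip fun ε σ _ => ∫ y in (0 : ℝ)..1, Φ ε σ y := by
  obtain ⟨⟨K, hK, hb⟩, hcont⟩ := h
  refine ⟨⟨K, hK, fun ε hε σ τ hσ hτ x => ⟨?_, ?_⟩⟩, fun _ _ _ _ => continuous_const⟩
  · simpa using intervalIntegral.norm_integral_le_of_norm_le_const (a := 0) (b := 1)
      (f := Φ ε σ) (C := K) fun y _ => (hb ε hε σ τ hσ hτ y).1
  · rw [← intervalIntegral.integral_sub ((hcont ε hε σ hσ).intervalIntegrable _ _)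
      ((hcont ε hε τ hτ).intervalIntegrable _ _)]
    simpa using intervalIntegral.norm_integral_le_of_norm_le_const (a := 0) (b := 1)
      (f := fun y => Φ ε σ y - Φ ε τ y) (C := K * ‖σ - τ‖) fun y _ => (hb ε hε σ τ hσ hτ y).2

end UnifLip

/-! ### Solving the boundary layer equation -/

/-- Radius `1/16` makes the nonlinearity a small perturbation of the linear part `2s`. -/
theorem cubic_remainder_bounds {a b r : ℝ} (ha : |a| ≤ 1 / 16) (hb : |b| ≤ 1 / 16)
    (har : |a| ≤ r) :
    |3 * a ^ 2 + a ^ 3| ≤ 1 / 4 * r ∧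
      |(3 * a ^ 2 + a ^ 3) - (3 * b ^ 2 + b ^ 3)| ≤ 1 / 2 * |a - b| := by
  have ha' := abs_le.1 ha
  have hb' := abs_le.1 hb
  constructor
  · have e : 3 * a ^ 2 + a ^ 3 = (3 * a + a ^ 2) * a := by ring
    rw [e, abs_mul]
    have : |3 * a + a ^ 2| ≤ 1 / 4 := by
      rw [abs_le]; constructor <;> nlinarith
    exact mul_le_mul this har (abs_nonneg _) (by norm_num)
  · have e : (3 * a ^ 2 + a ^ 3) - (3 * b ^ 2 + b ^ 3) =
        (3 * (a + b) + a ^ 2 + a * b + b ^ 2) * (a - b) := by ring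
    rw [e, abs_mul]
    refine mul_le_mul_of_nonneg_right ?_ (abs_nonneg _)
    rw [abs_le]; constructor <;> nlinarith

/-- The equation `ε² s'' = 2s + 3s² + s³ - ε g(s)` with `s(0) = s(1) = 0` has a solution of size
`O(ε)` with bounded derivative, for every uniformly Lipschitz nonlocal `g`. -/
theorem exists_boundary_layer {g : ℝ → C(Icc (0 : ℝ) 1, ℝ) → ℝ → ℝ} (hg : UnifLip g) :
    ∃ C > 0, ∃ ε₁ > 0, ε₁ ≤ 1 ∧ ∀ ε, 0 < ε → ε < ε₁ → ∃ (σ : C(Icc (0 : ℝ) 1, ℝ)) (s s₁ : ℝ → ℝ),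
      ‖σ‖ ≤ 1 / 16 ∧ ‖σ‖ ≤ C * ε ∧ (∀ x ∈ Icc (0 : ℝ) 1, s x = ext σ x) ∧
      (∀ x, HasDerivAt s (s₁ x) x) ∧
      (∀ x, HasDerivAt s₁ ((2 * s x + (3 * ext σ x ^ 2 + ext σ x ^ 3 - ε * g ε σ x)) / ε ^ 2) x) ∧
      (∀ x ∈ Icc (0 : ℝ) 1, |s₁ x| ≤ C) ∧ s 0 = 0 ∧ s 1 = 0 := by
  obtain ⟨⟨K, hK, hb⟩, hcont⟩ := hg
  -- `8 K` is the derivative bound, four times a source of size `2K k` divided by `k`; the threshold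
  -- ensures `ε K ≤ 1/16`.
  refine ⟨8 * K + 1, by positivity, 1 / (16 * (K + 1)), by positivity, ?_, fun ε hε hlt => ?_⟩
  · rw [div_le_one (by positivity)]; linarith
  have hεK : ε * (16 * (K + 1)) < 1 := by rwa [lt_div_iff₀ (by positivity)] at hlt
  have hεK' : ε * K ≤ 1 / 16 := by nlinarith
  have hε16 : ε ≤ 1 / 16 := by nlinarith [mul_nonneg hε.le hK]
  have hεI : ε ∈ Ioc (0 : ℝ) 1 := ⟨hε, by linarith⟩
  -- The linear part `ε²s'' = 2s` is `s'' = k²s`.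
  set k := √2 / ε with hkdef
  have hk2 : k ^ 2 = 2 / ε ^ 2 := by rw [hkdef, div_pow, Real.sq_sqrt zero_le_two]
  have hs2 : 1 ≤ √2 := Real.one_le_sqrt.2 (by norm_num)
  have hkε : 1 / ε ≤ k := div_le_div_of_nonneg_right hs2 hε.le
  have hk1 : 1 ≤ k := le_trans (by rw [le_div_iff₀ hε]; linarith) hkε
  have hk0 : 0 < k := by linarith
  set R : C(Icc (0 : ℝ) 1, ℝ) → ℝ → ℝ := fun σ x =>
    3 * ext σ x ^ 2 + ext σ x ^ 3 - ε * g ε σ x with hR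
  have cR : ∀ σ : C(Icc (0 : ℝ) 1, ℝ), ‖σ‖ ≤ 1 / 16 → Continuous fun x => -(R σ x / ε ^ 2) := by
    intro σ hσ
    have h1 := continuous_ext σ
    have h2 := hcont ε hεI σ hσ
    simp only [hR]
    fun_prop
  have bR : ∀ σ : C(Icc (0 : ℝ) 1, ℝ), ‖σ‖ ≤ 1 / 16 → ∀ x,
      |-(R σ x / ε ^ 2)| ≤ (1 / 4 * ‖σ‖ + ε * K) / ε ^ 2 := by
    intro σ hσ x
    rw [abs_neg, abs_div, abs_of_pos (pow_pos hε 2)]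
    refine div_le_div_of_nonneg_right ?_ (by positivity)
    have h1 := (cubic_remainder_bounds ((abs_ext_le σ x).trans hσ) ((abs_ext_le σ x).trans hσ)
      (abs_ext_le σ x)).1
    refine (abs_sub _ _).trans (add_le_add h1 ?_)
    rw [abs_mul, abs_of_pos hε]
    exact mul_le_mul_of_nonneg_left (hb ε hεI σ σ hσ hσ x).1 hε.le
  -- The cubic part contributes `1/2` and the force `1/16`, below `1` in total; the gain `ε²/2` of
  -- the Green operator then gives contraction factor `1/2`.
  have lR : ∀ σ τ : C(Icc (0 : ℝ) 1, ℝ), ‖σ‖ ≤ 1 / 16 → ‖τ‖ ≤ 1 / 16 → ∀ x,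
      |-(R σ x / ε ^ 2) - -(R τ x / ε ^ 2)| ≤ ‖σ - τ‖ / ε ^ 2 := by
    intro σ τ hσ hτ x
    have e : -(R σ x / ε ^ 2) - -(R τ x / ε ^ 2) = -((R σ x - R τ x) / ε ^ 2) := by ring
    rw [e, abs_neg, abs_div, abs_of_pos (pow_pos hε 2)]
    refine div_le_div_of_nonneg_right ?_ (by positivity)
    have h1 := (cubic_remainder_bounds ((abs_ext_le σ x).trans hσ) ((abs_ext_le τ x).trans hτ)
      (abs_ext_le σ x)).2
    have h2 := abs_ext_sub_le σ τ x
    have h3 := (hb ε hεI σ τ hσ hτ x).2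
    have e' : R σ x - R τ x = ((3 * ext σ x ^ 2 + ext σ x ^ 3) - (3 * ext τ x ^ 2 + ext τ x ^ 3)) -
        ε * (g ε σ x - g ε τ x) := by simp only [hR]; ring
    rw [e']
    refine (abs_sub _ _).trans ?_
    rw [abs_mul, abs_of_pos hε]
    have h4 : ε * |g ε σ x - g ε τ x| ≤ ε * (K * ‖σ - τ‖) := mul_le_mul_of_nonneg_left h3 hε.le
    have h5 : ε * K * ‖σ - τ‖ ≤ 1 / 16 * ‖σ - τ‖ :=
      mul_le_mul_of_nonneg_right hεK' (norm_nonneg _)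
    nlinarith [norm_nonneg (σ - τ)]
  classical
  let S : C(Icc (0 : ℝ) 1, ℝ) → C(Icc (0 : ℝ) 1, ℝ) := fun σ =>
    -- Continuity of the source is known only on the ball; the value outside it is immaterial.
    if h : ‖σ‖ ≤ 1 / 16 then
      ⟨fun x => green k (fun x => -(R σ x / ε ^ 2)) x,
        (continuous_green hk0 (cR σ h)).comp continuous_subtype_val⟩
    else 0
  have hS : ∀ σ : C(Icc (0 : ℝ) 1, ℝ), ‖σ‖ ≤ 1 / 16 → ∀ x : Icc (0 : ℝ) 1,
      S σ x = green k (fun x => -(R σ x / ε ^ 2)) x := by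
    intro σ h x
    simp only [S, dif_pos h]
    rfl
  have nS : ∀ σ : C(Icc (0 : ℝ) 1, ℝ), ‖σ‖ ≤ 1 / 16 → ‖S σ‖ ≤ (1 / 4 * ‖σ‖ + ε * K) / 2 := by
    intro σ hσ
    rw [ContinuousMap.norm_le _ (by positivity)]
    intro x
    rw [hS σ hσ, Real.norm_eq_abs]
    refine (abs_green_le hk0 (fun x _ => bR σ hσ x) x.2).trans (le_of_eq ?_)
    rw [hk2]
    field_simp
  set B : Set C(Icc (0 : ℝ) 1, ℝ) := Metric.closedBall 0 (1 / 16) with hB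
  have memB : ∀ σ, σ ∈ B ↔ ‖σ‖ ≤ 1 / 16 := fun σ => by simp [hB]
  have hmaps : MapsTo S B B := by
    intro σ hσ
    rw [memB] at hσ ⊢
    have := nS σ hσ
    linarith
  have hcontr : ContractingWith (1 / 2) (hmaps.restrict S B B) := by
    refine ⟨by norm_num, LipschitzWith.of_dist_le_mul fun σ τ => ?_⟩
    have hσ := (memB _).1 σ.2
    have hτ := (memB _).1 τ.2
    change dist (S σ) (S τ) ≤ _ * dist (σ : C(Icc (0 : ℝ) 1, ℝ)) τ
    rw [dist_eq_norm, dist_eq_norm, ContinuousMap.norm_le _ (by positivity)]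
    intro x
    rw [ContinuousMap.sub_apply, hS _ hσ, hS _ hτ, green_sub (cR _ hσ) (cR _ hτ),
      Real.norm_eq_abs]
    refine (abs_green_le hk0 (fun x _ => lR _ _ hσ hτ x) x.2).trans (le_of_eq ?_)
    rw [hk2]
    push_cast
    field_simp
  obtain ⟨σ, hσB, hfix, -⟩ := hcontr.exists_fixedPoint' Metric.isClosed_closedBall.isComplete hmaps
    (x := 0) (by rw [memB, norm_zero]; norm_num) (edist_ne_top _ _)
  rw [memB] at hσB
  have hfix' : S σ = σ := hfix
  have hsize : ‖σ‖ ≤ ε * K := by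
    have := nS σ hσB
    rw [hfix'] at this
    linarith [norm_nonneg σ]
  refine ⟨σ, green k (fun x => -(R σ x / ε ^ 2)), greenDeriv k (fun x => -(R σ x / ε ^ 2)), hσB,
    by nlinarith, ?_, hasDerivAt_green hk0 (cR σ hσB), ?_, ?_, green_zero _ _, green_one _ _⟩
  · intro x hx
    rw [ext, IccExtend_of_mem _ _ hx]
    conv_rhs => rw [← hfix']
    exact (hS σ hσB ⟨x, hx⟩).symm
  · intro x
    refine (hasDerivAt_greenDeriv hk0 (cR σ hσB) x).congr_deriv ?_
    rw [hk2]
    simp only [hR]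
    ring
  · intro x hx
    refine (abs_greenDeriv_le hk1 (fun x _ => bR σ hσB x) hx).trans ?_
    rw [div_le_iff₀ hk0]
    have h1 : (1 / 4 * ‖σ‖ + ε * K) / ε ^ 2 ≤ 2 * K * (1 / ε) := by
      rw [div_le_iff₀ (by positivity)]
      have : 2 * K * (1 / ε) * ε ^ 2 = 2 * (ε * K) := by field_simp
      rw [this]
      nlinarith [mul_nonneg hε.le hK]
    have h2 : 2 * K * (1 / ε) ≤ 2 * K * k := mul_le_mul_of_nonneg_left hkε (by positivity)
    nlinarith

/-! ### The Euler-Lagrange system -/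

section

variable (T L β : ℝ)

/-- `Lρ² + ε` with `ρ = 1 + σ`. -/
noncomputable def den (ε : ℝ) (σ : C(Icc (0 : ℝ) 1, ℝ)) (x : ℝ) : ℝ := L * (1 + ext σ x) ^ 2 + ε

/-- The Lagrange multiplier of the constraint `∫ θ' = β`, for given modulus `1 + σ`. -/
noncomputable def multiplier (ε : ℝ) (σ : C(Icc (0 : ℝ) 1, ℝ)) : ℝ :=
  (β - ∫ y in (0 : ℝ)..1, T * L * (den L ε σ y)⁻¹) *
    (∫ y in (0 : ℝ)..1, ((1 + ext σ y) ^ 2)⁻¹ * (den L ε σ y)⁻¹)⁻¹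

/-- The optimal twist for given modulus `1 + σ`. -/
noncomputable def optTwist (ε : ℝ) (σ : C(Icc (0 : ℝ) 1, ℝ)) (x : ℝ) : ℝ :=
  (T * L * (1 + ext σ x) ^ 2 + multiplier T L β ε σ) * (den L ε σ x)⁻¹

/-- The derivative of the optimal phase for given modulus `1 + σ`. -/
noncomputable def optFreq (ε : ℝ) (σ : C(Icc (0 : ℝ) 1, ℝ)) (x : ℝ) : ℝ :=
  optTwist T L β ε σ x * ((1 + ext σ x) ^ 2)⁻¹

variable {T L β}

theorem one_add_ext_mem {σ : C(Icc (0 : ℝ) 1, ℝ)} (hσ : ‖σ‖ ≤ 1 / 16) (x : ℝ) :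
    15 / 16 ≤ 1 + ext σ x ∧ 1 + ext σ x ≤ 17 / 16 := by
  have := abs_le.1 ((abs_ext_le σ x).trans hσ)
  constructor <;> linarith [this.1, this.2]

theorem half_le_sq {σ : C(Icc (0 : ℝ) 1, ℝ)} (hσ : ‖σ‖ ≤ 1 / 16) (x : ℝ) :
    1 / 2 ≤ (1 + ext σ x) ^ 2 ∧ (1 + ext σ x) ^ 2 ≤ 2 := by
  obtain ⟨h1, h2⟩ := one_add_ext_mem hσ x
  constructor <;> nlinarith

theorem den_bounds (hL : 0 < L) {ε : ℝ} (hε : ε ∈ Ioc (0 : ℝ) 1) {σ : C(Icc (0 : ℝ) 1, ℝ)}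
    (hσ : ‖σ‖ ≤ 1 / 16) (x : ℝ) : L / 2 ≤ den L ε σ x ∧ den L ε σ x ≤ 2 * L + 1 := by
  obtain ⟨h1, h2⟩ := half_le_sq hσ x
  rw [den]
  constructor <;> nlinarith [hε.1, hε.2]

theorem unifLip_modulus : UnifLip fun _ σ x => 1 + ext σ x := (UnifLip.const 1).add .eval

theorem unifLip_modulus_sq_inv : UnifLip fun _ σ x => ((1 + ext σ x) ^ 2)⁻¹ :=
  (unifLip_modulus.pow 2).inv (c := 1 / 2) (by norm_num) fun _ _ _ hσ x => (half_le_sq hσ x).1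

theorem unifLip_den_inv (hL : 0 < L) : UnifLip fun ε σ x => (den L ε σ x)⁻¹ :=
  (((UnifLip.const L).mul (unifLip_modulus.pow 2)).add .param).inv (c := L / 2) (by positivity)
    fun _ hε _ hσ x => (den_bounds hL hε hσ x).1

theorem integral_weight_ge (hL : 0 < L) {ε : ℝ} (hε : ε ∈ Ioc (0 : ℝ) 1)
    {σ : C(Icc (0 : ℝ) 1, ℝ)} (hσ : ‖σ‖ ≤ 1 / 16) :
    (2 * (2 * L + 1))⁻¹ ≤ ∫ y in (0 : ℝ)..1, ((1 + ext σ y) ^ 2)⁻¹ * (den L ε σ y)⁻¹ := by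
  have hc := (unifLip_modulus_sq_inv.mul (unifLip_den_inv hL)).2 ε hε σ hσ
  have := intervalIntegral.integral_mono_on (μ := volume) (a := 0) (b := 1) zero_le_one
    (f := fun _ => (2 * (2 * L + 1))⁻¹) (continuous_const.intervalIntegrable _ _)
    (hc.intervalIntegrable _ _) fun x _ => by
      obtain ⟨h1, h2⟩ := half_le_sq hσ x
      obtain ⟨h3, h4⟩ := den_bounds hL hε hσ x
      have h5 : 0 < den L ε σ x := by linarith
      rw [mul_inv]
      exact mul_le_mul (inv_anti₀ (by linarith) h2) (inv_anti₀ h5 h4) (by positivity)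
        (by positivity)
  simpa using this

theorem unifLip_multiplier (hL : 0 < L) : UnifLip fun ε σ _ => multiplier T L β ε σ :=
  ((UnifLip.const β).sub ((UnifLip.const (T * L)).mul (unifLip_den_inv hL)).integral).mul
    ((unifLip_modulus_sq_inv.mul (unifLip_den_inv hL)).integral.inv
      (c := (2 * (2 * L + 1))⁻¹) (by positivity) fun _ hε _ hσ _ => integral_weight_ge hL hε hσ)

theorem unifLip_optTwist (hL : 0 < L) : UnifLip (optTwist T L β) :=
  (((UnifLip.const (T * L)).mul (unifLip_modulus.pow 2)).add (unifLip_multiplier hL)).mul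
    (unifLip_den_inv hL)

theorem unifLip_optFreq (hL : 0 < L) : UnifLip (optFreq T L β) :=
  (unifLip_optTwist hL).mul unifLip_modulus_sq_inv

theorem unifLip_force (hL : 0 < L) : UnifLip fun ε σ x =>
    (ε * optTwist T L β ε σ x ^ 2 - 2 * multiplier T L β ε σ * optTwist T L β ε σ x) *
      ((1 + ext σ x) ^ 3)⁻¹ := by
  refine ((UnifLip.param.mul ((unifLip_optTwist hL).pow 2)).sub
    (((UnifLip.const 2).mul (unifLip_multiplier hL)).mul (unifLip_optTwist hL))).mul
    ((unifLip_modulus.pow 3).inv (c := 1 / 2) (by norm_num) fun _ _ _ hσ x => ?_)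
  have h := one_add_ext_mem hσ x
  calc (1 / 2 : ℝ) ≤ (15 / 16) ^ 3 := by norm_num
    _ ≤ _ := pow_le_pow_left₀ (by norm_num) h.1 3

/-- The Euler-Lagrange equation in the twist, multiplied by `ρ²`. -/
theorem multiplier_eq (hL : 0 < L) {ε : ℝ} (hε : ε ∈ Ioc (0 : ℝ) 1) {σ : C(Icc (0 : ℝ) 1, ℝ)}
    (hσ : ‖σ‖ ≤ 1 / 16) (x : ℝ) :
    multiplier T L β ε σ = ε * optTwist T L β ε σ x +
      L * (1 + ext σ x) ^ 2 * (optTwist T L β ε σ x - T) := by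
  have h : den L ε σ x ≠ 0 := by
    have := (den_bounds hL hε hσ x).1
    linarith
  have e : optTwist T L β ε σ x * den L ε σ x =
      T * L * (1 + ext σ x) ^ 2 + multiplier T L β ε σ := by
    rw [optTwist, inv_mul_cancel_right₀ h]
  rw [den] at e
  linear_combination -e

/-- The frequency is affine in the multiplier, and `multiplier` is by definition the root of this
linear equation. -/
theorem integral_optFreq (hL : 0 < L) {ε : ℝ} (hε : ε ∈ Ioc (0 : ℝ) 1)
    {σ : C(Icc (0 : ℝ) 1, ℝ)} (hσ : ‖σ‖ ≤ 1 / 16) :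
    ∫ y in (0 : ℝ)..1, optFreq T L β ε σ y = β := by
  have c1 := (unifLip_den_inv hL).2 ε hε σ hσ
  have c2 := (unifLip_modulus_sq_inv.mul (unifLip_den_inv hL)).2 ε hε σ hσ
  have e : ∀ y, optFreq T L β ε σ y = T * L * (den L ε σ y)⁻¹ +
      multiplier T L β ε σ * (((1 + ext σ y) ^ 2)⁻¹ * (den L ε σ y)⁻¹) := by
    intro y
    have h1 : (1 + ext σ y) ^ 2 ≠ 0 := by
      have := (half_le_sq hσ y).1
      positivity
    rw [optFreq, optTwist, add_mul, add_mul, mul_assoc (T * L), mul_comm ((1 + ext σ y) ^ 2),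
      ← mul_assoc (T * L), mul_assoc, mul_inv_cancel₀ h1]
    ring
  simp_rw [e]
  rw [intervalIntegral.integral_add ((c1.intervalIntegrable _ _).const_mul _)
    ((c2.intervalIntegrable _ _).const_mul _), 
    intervalIntegral.integral_const_mul (r := multiplier T L β ε σ), multiplier]
  have hpos : (∫ y in (0 : ℝ)..1, ((1 + ext σ y) ^ 2)⁻¹ * (den L ε σ y)⁻¹) ≠ 0 := by
    have := integral_weight_ge hL hε hσ
    have h2 : 0 < (2 * (2 * L + 1))⁻¹ := by positivity
    linarith
  rw [inv_mul_cancel_right₀ hpos]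
  ring

theorem ext_zero (x : ℝ) : ext 0 x = 0 := rfl

/-- For unit modulus the frequency is constant, hence equal to its mean. With the Lipschitz bound
this yields `|θ' - β| = O(‖σ‖)`. -/
theorem optFreq_zero (hL : 0 < L) {ε : ℝ} (hε : ε ∈ Ioc (0 : ℝ) 1) (x : ℝ) :
    optFreq T L β ε 0 x = β := by
  have h := integral_optFreq (T := T) (β := β) hL hε (σ := 0) (by simp)
  have hc : ∀ y, optFreq T L β ε 0 y = optFreq T L β ε 0 x := fun y => by
    simp only [optFreq, optTwist, den, ext_zero]
  simp_rw [hc] at h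
  simpa using h

/-- For small `ε` there is a local minimizer `ρ e^{iθ}` whose modulus is `O(ε)`-close to one and
whose phase has derivative `O(ε)`-close to the constant `β`. -/
theorem exists_polar_minimizer {N : ℕ} {α : ℝ} (hL : 0 < L)
    (hβ : Complex.exp (Complex.I * (β : ℂ)) = Complex.exp (Complex.I * α)) :
    ∃ C > 0, ∃ ε₀ > 0, ε₀ ≤ 1 ∧ ∀ ε, 0 < ε → ε < ε₀ → ∃ ρ ρ₁ θ q : ℝ → ℝ,
      (∀ x, HasDerivAt ρ (ρ₁ x) x) ∧ Continuous ρ₁ ∧ (∀ x, HasDerivAt θ (q x) x) ∧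
      Continuous q ∧ θ 0 = 0 ∧ θ 1 = β ∧
      IsH1LocalMinimizer (energy N L ε) (admissible α) (polar ρ θ) ∧
      ∀ x ∈ Icc (0 : ℝ) 1, |ρ x - 1| ≤ 1 / 16 ∧ |ρ x - 1| ≤ C * ε ∧ |ρ₁ x| ≤ C ∧
        |q x - β| ≤ C * ε := by
  set T := 2 * Real.pi * (N : ℝ) with hT
  obtain ⟨C, hC, ε₁, hε₁, hε₁1, hsol⟩ := exists_boundary_layer (unifLip_force (T := T) (β := β) hL)
  obtain ⟨⟨K₀, hK₀, hb₀⟩, hc₀⟩ := unifLip_optFreq (T := T) (β := β) hL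
  -- `K₁` and `K₂` bound `εp - l` and `εp²/2 - lp` uniformly in `ε`, so the convexity condition `Q ≤
  -- 1/(4ε)` holds for small `ε`.
  obtain ⟨⟨K₁, hK₁, hb₁⟩, -⟩ := (UnifLip.param.mul (unifLip_optTwist (T := T) (β := β) hL)).sub
    (unifLip_multiplier (T := T) (β := β) hL)
  obtain ⟨⟨K₂, hK₂, hb₂⟩, -⟩ :=
    ((UnifLip.param.mul ((unifLip_optTwist (T := T) (β := β) hL).pow 2)).mul (.const 2⁻¹)).sub
      ((unifLip_multiplier (T := T) (β := β) hL).mul (unifLip_optTwist (T := T) (β := β) hL))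
  set K := K₁ + K₂ with hK
  set Q := 16 * K + 32 * K ^ 2 / L with hQ
  have hQ0 : 0 ≤ Q := by positivity
  refine ⟨C + K₀ * C, by positivity, min ε₁ (1 / (4 * (Q + 1))), by positivity,
    (min_le_left _ _).trans hε₁1, fun ε hε hlt => ?_⟩
  have hlt1 := hlt.trans_le (min_le_left _ _)
  have hlt2 := hlt.trans_le (min_le_right _ _)
  have hεI : ε ∈ Ioc (0 : ℝ) 1 := ⟨hε, (hlt1.trans_le hε₁1).le⟩
  obtain ⟨σ, s, s₁, hσ, hσε, hs, hd, hd₁, hbd, hs0, hs1⟩ := hsol ε hε hlt1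
  have cs : Continuous s := continuous_iff_continuousAt.2 fun x => (hd x).continuousAt
  have cs₁ : Continuous s₁ := continuous_iff_continuousAt.2 fun x => (hd₁ x).continuousAt
  have cq : Continuous (optFreq T L β ε σ) := hc₀ ε hεI σ hσ
  have hθ : ∀ x, HasDerivAt (fun x => ∫ y in (0 : ℝ)..x, optFreq T L β ε σ y)
      (optFreq T L β ε σ x) x := fun x =>
    intervalIntegral.integral_hasDerivAt_right (cq.intervalIntegrable _ _)
      cq.stronglyMeasurable.stronglyMeasurableAtFilter cq.continuousAt
  have hρ : ∀ x, HasDerivAt (fun x => 1 + s x) (s₁ x) x := fun x => (hd x).const_add 1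
  have hθ1 := integral_optFreq (T := T) (β := β) hL hεI hσ
  have hpq : ∀ x ∈ Icc (0 : ℝ) 1, (1 + s x) ^ 2 * optFreq T L β ε σ x = optTwist T L β ε σ x := by
    intro x hx
    have h1 : (1 + ext σ x) ^ 2 ≠ 0 := by
      have := (half_le_sq hσ x).1
      positivity
    rw [hs x hx, optFreq, mul_comm, inv_mul_cancel_right₀ h1]
  have hclose : ∀ x ∈ Icc (0 : ℝ) 1, |1 + s x - 1| ≤ ‖σ‖ := fun x hx => by
    rw [add_sub_cancel_left, hs x hx]; exact abs_ext_le σ x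
  refine ⟨fun x => 1 + s x, s₁, fun x => ∫ y in (0 : ℝ)..x, optFreq T L β ε σ y,
    optFreq T L β ε σ, hρ, cs₁, hθ, cq, by simp, hθ1, ?_, fun x hx => ⟨?_, ?_, ?_, ?_⟩⟩
  · have cg := (unifLip_force (T := T) (β := β) hL).2 ε hεI σ hσ
    have ce := continuous_ext σ
    refine polar_isH1LocalMinimizer (l := multiplier T L β ε σ) (K := K) hL hε hρ hd₁ ?_ hθ cq
      (by simp [hs0]) (by simp [hs1]) (by simp) ?_ (fun x hx => (hclose x hx).trans (by linarith))
      ?_ ?_ ?_ ?_ ?_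
    · exact (((continuous_const.mul cs).add (((continuous_const.mul (ce.pow 2)).add
        (ce.pow 3)).sub (continuous_const.mul cg)))).div_const _
    · simp only [hθ1]; exact hβ
    · intro x hx
      rw [hpq x hx, hs x hx]
      exact multiplier_eq hL hεI hσ x
    · intro x hx
      rw [hpq x hx]
      exact ((hb₁ ε hεI σ σ hσ hσ x).1).trans (by linarith)
    · intro x hx
      rw [hpq x hx, div_eq_mul_inv]
      exact ((hb₂ ε hεI σ σ hσ hσ x).1).trans (by linarith)
    · rw [← hQ, le_div_iff₀ (by positivity)]
      rw [lt_div_iff₀ (by positivity)] at hlt2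
      nlinarith
    · intro x hx
      rw [hpq x hx, hs x hx]
      have h1 : 1 + ext σ x ≠ 0 := by
        have := (one_add_ext_mem hσ x).1
        linarith
      field_simp
      ring
  · exact (hclose x hx).trans hσ
  · refine (hclose x hx).trans (hσε.trans (mul_le_mul_of_nonneg_right ?_ hε.le))
    have : 0 ≤ K₀ * C := by positivity
    linarith
  · have : 0 ≤ K₀ * C := by positivity
    exact (hbd x hx).trans (by linarith)
  · have h1 := (hb₀ ε hεI σ 0 hσ (by simp) x).2
    rw [optFreq_zero hL hεI, sub_zero] at h1
    have h2 : K₀ * ‖σ‖ ≤ K₀ * (C * ε) := mul_le_mul_of_nonneg_left hσε hK₀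
    have h3 : 0 ≤ C * ε := by positivity
    linarith

end

/-! ### Asymptotics -/

/-- The gradient is bounded and weighted by `ε`, the well is `O(ε²)/ε`, and the twist `ρ²q` is `β +
O(ε)`. -/
theorem abs_energy_polar_sub_le {ρ ρ₁ θ q : ℝ → ℝ} {N : ℕ} {L β C ε : ℝ} (hL : 0 < L) (hε : 0 < ε)
    (hε1 : ε ≤ 1) (hC : 0 < C) (hρ : ∀ x, HasDerivAt ρ (ρ₁ x) x) (hρ₁ : Continuous ρ₁)
    (hθ : ∀ x, HasDerivAt θ (q x) x) (hq : Continuous q)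
    (h : ∀ x ∈ Icc (0 : ℝ) 1, |ρ x - 1| ≤ 1 / 16 ∧ |ρ x - 1| ≤ C * ε ∧ |ρ₁ x| ≤ C ∧
        |q x - β| ≤ C * ε) :
    |energy N L ε (polar ρ θ) - L / 2 * (β - 2 * Real.pi * N) ^ 2| ≤
      (C ^ 2 + 2 * (|β| + C) ^ 2 + 3 * C ^ 2 + L / 2 * ((3 * C * (|β| + C) + C) *
        (2 * |β - 2 * Real.pi * N| + (3 * C * (|β| + C) + C)))) * ε := by
  set T := 2 * Real.pi * (N : ℝ) with hT
  set C₂ := 3 * C * (|β| + C) + C with hC₂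
  have hC₂0 : 0 < C₂ := by positivity
  have cρ : Continuous ρ := continuous_iff_continuousAt.2 fun x => (hρ x).continuousAt
  have hpos : ∀ x ∈ Icc (0 : ℝ) 1, 0 < ρ x := fun x hx => by
    have := abs_le.1 (h x hx).1
    linarith
  have hc : Continuous fun x => ε / 2 * (ρ₁ x ^ 2 + ρ x ^ 2 * q x ^ 2) +
      1 / (4 * ε) * (ρ x ^ 2 - 1) ^ 2 + L / 2 * (ρ x ^ 2 * q x - T) ^ 2 := by fun_prop
  rw [energy_polar N L ε hρ hρ₁ hθ hq hpos, integral_unitMeasure]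
  have e : L / 2 * (β - T) ^ 2 = ∫ _ in (0 : ℝ)..1, L / 2 * (β - T) ^ 2 := by simp
  rw [e, ← intervalIntegral.integral_sub (hc.intervalIntegrable _ _)
    (continuous_const.intervalIntegrable _ _), ← Real.norm_eq_abs]
  refine (intervalIntegral.norm_integral_le_of_norm_le_const fun x hx => ?_).trans
    (le_of_eq (by rw [sub_zero, abs_one, mul_one]))
  have hxI : x ∈ Icc (0 : ℝ) 1 := by simpa using uIoc_subset_uIcc hx
  obtain ⟨h1, h2, h3, h4⟩ := h x hxI
  have h1' := abs_le.1 h1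
  have hCε : C * ε ≤ C := by nlinarith
  have hqb : |q x| ≤ |β| + C := by
    have := abs_add_le (q x - β) β
    rw [sub_add_cancel] at this
    linarith
  have hρ2 : |ρ x ^ 2 - 1| ≤ 3 * C * ε := by
    have e : ρ x ^ 2 - 1 = (ρ x + 1) * (ρ x - 1) := by ring
    rw [e, abs_mul]
    have : |ρ x + 1| ≤ 3 := by rw [abs_le]; constructor <;> linarith [h1'.1, h1'.2]
    calc _ ≤ 3 * (C * ε) := mul_le_mul this h2 (abs_nonneg _) (by norm_num)
      _ = _ := by ring
  have hpβ : |ρ x ^ 2 * q x - β| ≤ C₂ * ε := by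
    have e : ρ x ^ 2 * q x - β = (ρ x ^ 2 - 1) * q x + (q x - β) := by ring
    rw [e]
    refine (abs_add_le _ _).trans ?_
    rw [abs_mul]
    have := mul_le_mul hρ2 hqb (abs_nonneg _) (by positivity)
    calc _ ≤ 3 * C * ε * (|β| + C) + C * ε := add_le_add this h4
      _ = _ := by rw [hC₂]; ring
  have t1 : |ε / 2 * (ρ₁ x ^ 2 + ρ x ^ 2 * q x ^ 2)| ≤ (C ^ 2 + 2 * (|β| + C) ^ 2) * ε := by
    rw [abs_of_nonneg (by positivity)]
    have a1 : ρ₁ x ^ 2 ≤ C ^ 2 := sq_le_sq' (abs_le.1 h3).1 (abs_le.1 h3).2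
    have a2 : q x ^ 2 ≤ (|β| + C) ^ 2 := sq_le_sq' (abs_le.1 hqb).1 (abs_le.1 hqb).2
    have a3 : ρ x ^ 2 ≤ 2 := by nlinarith [hpos x hxI]
    have a4 : ρ x ^ 2 * q x ^ 2 ≤ 2 * (|β| + C) ^ 2 :=
      mul_le_mul a3 a2 (sq_nonneg _) (by norm_num)
    nlinarith [sq_nonneg (ρ₁ x), mul_nonneg (sq_nonneg (ρ x)) (sq_nonneg (q x))]
  have t2 : |1 / (4 * ε) * (ρ x ^ 2 - 1) ^ 2| ≤ 3 * C ^ 2 * ε := by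
    rw [abs_of_nonneg (by positivity)]
    have a1 : (ρ x ^ 2 - 1) ^ 2 ≤ (3 * C * ε) ^ 2 :=
      sq_le_sq' (abs_le.1 hρ2).1 (abs_le.1 hρ2).2
    calc _ ≤ 1 / (4 * ε) * (3 * C * ε) ^ 2 := mul_le_mul_of_nonneg_left a1 (by positivity)
      _ = 9 / 4 * C ^ 2 * ε := by field_simp; ring
      _ ≤ _ := by
        have : 0 ≤ C ^ 2 * ε := by positivity
        linarith
  have t3 : |L / 2 * (ρ x ^ 2 * q x - T) ^ 2 - L / 2 * (β - T) ^ 2| ≤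
      L / 2 * (C₂ * (2 * |β - T| + C₂)) * ε := by
    have e : L / 2 * (ρ x ^ 2 * q x - T) ^ 2 - L / 2 * (β - T) ^ 2 =
        L / 2 * ((ρ x ^ 2 * q x - β) * (2 * (β - T) + (ρ x ^ 2 * q x - β))) := by ring
    rw [e, abs_mul, abs_of_pos (by positivity : 0 < L / 2), abs_mul, mul_assoc]
    refine mul_le_mul_of_nonneg_left ?_ (by positivity)
    have a1 : |2 * (β - T) + (ρ x ^ 2 * q x - β)| ≤ 2 * |β - T| + C₂ := by
      refine (abs_add_le _ _).trans ?_
      rw [abs_mul, abs_two]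
      have : C₂ * ε ≤ C₂ := by nlinarith
      linarith
    calc _ ≤ C₂ * ε * (2 * |β - T| + C₂) := mul_le_mul hpβ a1 (abs_nonneg _) (by positivity)
      _ = _ := by ring
  rw [Real.norm_eq_abs, add_sub_assoc]
  refine (abs_add_le _ _).trans ?_
  have := abs_add_le (ε / 2 * (ρ₁ x ^ 2 + ρ x ^ 2 * q x ^ 2)) (1 / (4 * ε) * (ρ x ^ 2 - 1) ^ 2)
  linarith

end CholestericTwist

theorem theorem2p3 (N : ℕ) (hN : 0 < N) (L : ℝ) (hL : 0 < L)
    (M : ℕ) (hM : 0 < M) (α : ℝ) (hα : α ∈ Set.Ico (0 : ℝ) (2 * Real.pi)) :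
    ∃ ε₀ : ℝ, 0 < ε₀ ∧ ∃ (u : ℝ → ℝ → ℂ) (ρ θ : ℝ → ℝ → ℝ),
      (∀ ε : ℝ, 0 < ε → ε < ε₀ →
        CholestericTwist.IsH1LocalMinimizer (CholestericTwist.energy N L ε)
          (CholestericTwist.admissible α) (u ε) ∧
        CholestericTwist.MemH1 (ρ ε) ∧ CholestericTwist.MemH1 (θ ε) ∧
        (∀ x ∈ Set.Icc (0 : ℝ) 1, 0 < ρ ε x ∧
          u ε x = (ρ ε x : ℂ) * Complex.exp (Complex.I * (θ ε x : ℂ))) ∧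
        θ ε 0 = 0 ∧ θ ε 1 = 2 * Real.pi * M + α ∧
        ContDiffOn ℝ 1 (θ ε) (Set.Icc (0 : ℝ) 1)) ∧
      Filter.limsup (fun ε : ℝ =>
          eLpNorm (fun x => ρ ε x - 1) ⊤ CholestericTwist.unitMeasure / ENNReal.ofReal ε)
        (𝓝[>] (0 : ℝ)) < ⊤ ∧
      TendstoUniformlyOn (fun ε x => derivWithin (θ ε) (Set.Icc (0 : ℝ) 1) x)
        (fun _ => 2 * Real.pi * M + α) (𝓝[>] (0 : ℝ)) (Set.Icc (0 : ℝ) 1) ∧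
      Tendsto (fun ε => CholestericTwist.energy N L ε (u ε)) (𝓝[>] (0 : ℝ))
        (𝓝 (L / 2 * (2 * Real.pi * ((M : ℝ) - N) + α) ^ 2)) := by
  set β : ℝ := 2 * Real.pi * M + α with hβ
  have hexp : Complex.exp (Complex.I * (β : ℂ)) = Complex.exp (Complex.I * α) := by
    rw [Complex.exp_eq_exp_iff_exists_int]
    refine ⟨M, ?_⟩
    rw [hβ]; push_cast; ring
  obtain ⟨C, hC, ε₀, hε₀, hε₀1, H⟩ :=
    CholestericTwist.exists_polar_minimizer (N := N) (β := β) hL hexp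
  -- Outside `(0, ε₀)` the chosen functions are arbitrary, which limits at `0⁺` do not see.
  choose! ρ ρ₁ θ q hρ hρ₁ hθ hq hθ0 hθ1 hmin hb using H
  have hev : ∀ᶠ ε in 𝓝[>] (0 : ℝ), 0 < ε ∧ ε < ε₀ := Ioo_mem_nhdsGT hε₀
  have hlim : ∀ A : ℝ, Tendsto (fun ε : ℝ => A * ε) (𝓝[>] (0 : ℝ)) (𝓝 0) := fun A => by
    have : Tendsto (fun ε : ℝ => A * ε) (𝓝 0) (𝓝 (A * 0)) := (continuous_const_mul A).tendsto 0
    rw [mul_zero] at this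
    exact this.mono_left nhdsWithin_le_nhds
  refine ⟨ε₀, hε₀, fun ε => CholestericTwist.polar (ρ ε) (θ ε), ρ, θ,
    fun ε h1 h2 => ⟨hmin ε h1 h2, .of_hasDerivAt (hρ ε h1 h2) (hρ₁ ε h1 h2),
      .of_hasDerivAt (hθ ε h1 h2) (hq ε h1 h2), fun x hx => ⟨?_, rfl⟩, hθ0 ε h1 h2, hθ1 ε h1 h2, ?_⟩,
    ?_, ?_, ?_⟩
  · have := abs_le.1 (hb ε h1 h2 x hx).1
    linarith
  · refine (contDiff_one_iff_deriv.2 ⟨fun x => (hθ ε h1 h2 x).differentiableAt, ?_⟩).contDiffOn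
    rw [show deriv (θ ε) = q ε from funext fun x => (hθ ε h1 h2 x).deriv]
    exact hq ε h1 h2
  · refine lt_of_le_of_lt (limsup_le_of_le (h := ?_)) (ENNReal.ofReal_lt_top (r := C))
    filter_upwards [hev] with ε hε
    refine ENNReal.div_le_of_le_mul ?_
    rw [← ENNReal.ofReal_mul hC.le, eLpNorm_exponent_top]
    exact eLpNormEssSup_le_of_ae_bound (CholestericTwist.ae_unitMeasure_iff.2 (ae_of_all _
      fun x hx => (hb ε hε.1 hε.2 x (Ioo_subset_Icc_self hx)).2.1))
  · rw [Metric.tendstoUniformlyOn_iff]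
    intro η hη
    filter_upwards [hev, (hlim C).eventually (gt_mem_nhds hη)] with ε hε hCε x hx
    rw [(hθ ε hε.1 hε.2 x).hasDerivWithinAt.derivWithin (uniqueDiffOn_Icc zero_lt_one x hx),
      dist_comm, Real.dist_eq]
    exact ((hb ε hε.1 hε.2 x hx).2.2.2).trans_lt hCε
  · have e : L / 2 * (2 * Real.pi * ((M : ℝ) - N) + α) ^ 2 =
        L / 2 * (β - 2 * Real.pi * N) ^ 2 := by rw [hβ]; ring
    obtain ⟨A, hA⟩ : ∃ A, ∀ ε, 0 < ε → ε < ε₀ →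
        |CholestericTwist.energy N L ε (CholestericTwist.polar (ρ ε) (θ ε)) -
          L / 2 * (β - 2 * Real.pi * N) ^ 2| ≤ A * ε :=
      ⟨_, fun ε h1 h2 => CholestericTwist.abs_energy_polar_sub_le hL h1 (h2.le.trans hε₀1) hC
        (hρ ε h1 h2) (hρ₁ ε h1 h2) (hθ ε h1 h2) (hq ε h1 h2) (hb ε h1 h2)⟩
    rw [e, tendsto_iff_norm_sub_tendsto_zero]
    refine squeeze_zero' (Eventually.of_forall fun _ => norm_nonneg _) ?_ (hlim A)
    filter_upwards [hev] with ε hε using hA ε hε.1 hε.2
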